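/- **Conventions.** Let $\{0,1\}^*$ be the set of finite binary strings and $|s|$ the length of $s$. A *prefix-free machine* is a partial recursive function $C\colon\{0,1\}^*\to\{0,1\}^*$ such that no string in $\operatorname{Dom} C$ is a prefix of another string in $\operatorname{Dom} C$; put $H_C(s)=\min\{|p| : C(p)=s\}$ ($=\infty$ if there is no such $p$). A prefix-free machine $V$ is *optimal* if for every prefix-free machine $C$ there is $d\in\mathbb N$ such that for every $p\in\operatorname{Dom}C$ there is $q\in\operatorname{Dom}V$ with $V(q)=C(p)$ and $|q|\le|p|+d$. Let $U$ be any optimal prefix-free machine, used as the reference machine, and write $H=H_U$. For $\alpha\in\mathbb R$ and $n\ge 1$, let $\alpha{\restriction}_n\in\{0,1\}^*$ be the first $n$ bits of the base-two expansion of $\alpha-\lfloor\alpha\rfloor$ with infinitely many zeros. The real $\alpha$ is *computable* if there is a total recursive $f\colon\mathbb N^+\to\mathbb Q$ with $|\alpha-f(n)|<1/n$ for all $n\ge1$, and *left-computable* if there is a total recursive $f\colon\mathbb N^+\to\mathbb Q$ with $f(n)\le\alpha$ for all $n\ge 1$ and $\lim_{n\to\infty} f(n)=\alpha$. For $T\in(0,1]$,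 the real $\alpha$ is *weakly Chaitin $T$-random* if there is $c\in\mathbb N$ with $Tn-c\le H(\alpha{\restriction}_n)$ for all $n\ge1$, and *strictly $T$-compressible* if there is $d\in\mathbb N$ with $H(\alpha{\restriction}_n)\le Tn+d$ for all $n\ge1$. For an optimal prefix-free machine $V$ and a real $T>0$, let $$\mathrm{CS}_V(T)=\sum_{s\in\{0,1\}^*,\ H_V(s)<|s|}2^{-|s|/T}\in[0,\infty].$$ **Theorem.** Let $V$ be an optimal prefix-free machine and let $T>0$ be a real. 1. If $T$ is computable and $0<T\le1$, then $\mathrm{CS}_V(T)$ converges and is a left-computable real which is weakly Chaitin $T$-random. 2. If $T$ is computable and $0<T<1$, then $\mathrm{CS}_V(T)$ converges and is strictly $T$-compressible. 3. If $T>1$, then $\mathrm{CS}_V(T)$ diverges to $\infty$. -/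

import Mathlib

open scoped ENNReal

noncomputable section

namespace CompressibleStrings

/-- A set of finite binary strings is prefix-free if no string in it is a prefix of another one. -/
def PrefixFree (S : Set (List Bool)) : Prop :=
  ∀ p ∈ S, ∀ q ∈ S, p <+: q → p = q

/-- A prefix-free machine: a partial recursive function from finite binary strings to finite
binary strings whose domain of definition is prefix-free. -/
def IsPrefixFreeMachine (C : List Bool →. List Bool) : Prop :=
  Partrec C ∧ PrefixFree C.Dom

/-- `V` is optimal if for each prefix-free machine `C` there is `d` such that every `p ∈ Dom C`
has some `q ∈ Dom V` with `V(q) = C(p)` and `|q| ≤ |p| + d`. -/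
def IsOptimalPrefixFreeMachine (V : List Bool →. List Bool) : Prop :=
  IsPrefixFreeMachine V ∧
    ∀ C : List Bool →. List Bool, IsPrefixFreeMachine C →
      ∃ d : ℕ, ∀ p s : List Bool, s ∈ C p → ∃ q : List Bool, s ∈ V q ∧ q.length ≤ p.length + d

/-- The program-size complexity `H_C(s) = min {|p| : C(p) = s}`, which is `∞` if there is no
such `p`. -/
def complexity (C : List Bool →. List Bool) (s : List Bool) : ℕ∞ :=
  ⨅ (p : List Bool) (_ : s ∈ C p), (p.length : ℕ∞)

/-- A sequence of rationals is recursive: sign parts of the numerator and the (positive)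
denominator are total recursive functions of the index. -/
def RecursiveRatSeq (f : ℕ → ℚ) : Prop :=
  ∃ a b c : ℕ → ℕ, Computable a ∧ Computable b ∧ Computable c ∧
    ∀ n, f n = ((a n : ℚ) - (b n : ℚ)) / ((c n : ℚ) + 1)

/-- Right-computable reals. -/
def RightComputable (α : ℝ) : Prop :=
  ∃ f : ℕ → ℚ, RecursiveRatSeq f ∧ (∀ n : ℕ, 1 ≤ n → α ≤ (f n : ℝ)) ∧
    Filter.Tendsto (fun n => (f n : ℝ)) Filter.atTop (nhds α)

/-- Left-computable reals. -/
def LeftComputable (α : ℝ) : Prop :=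
  RightComputable (-α)

/-- Computable reals. -/
def ComputableReal (α : ℝ) : Prop :=
  ∃ f : ℕ → ℚ, RecursiveRatSeq f ∧ ∀ n : ℕ, 1 ≤ n → |α - (f n : ℝ)| < 1 / (n : ℝ)

/-- The first `n` bits of the base-two expansion of `α - ⌊α⌋` with infinitely many zeros:
the `i`-th bit (counted from `i = 0`) is `⌊(α - ⌊α⌋) 2 ^ (i + 1)⌋ mod 2`. -/
def firstBits (α : ℝ) (n : ℕ) : List Bool :=
  List.ofFn fun i : Fin n => decide (Real.digits (Int.fract α) 2 i = 1)

/-- Weak Chaitin `T`-randomness of `α`, complexity being measured by the optimal prefix-free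
machine `U`: there is `c` with `T n - c ≤ H_U(α↾n)` for all `n ≥ 1`. -/
def WeaklyChaitinRandom (U : List Bool →. List Bool) (T α : ℝ) : Prop :=
  ∃ c : ℕ, ∀ n : ℕ, 1 ≤ n →
    ((T * n - c : ℝ) : EReal) ≤ ((complexity U (firstBits α n) : ℝ≥0∞) : EReal)

/-- Strict `T`-compressibility of `α`, complexity being measured by the optimal prefix-free
machine `U`: there is `d` with `H_U(α↾n) ≤ T n + d` for all `n ≥ 1`. -/
def StrictlyCompressible (U : List Bool →. List Bool) (T α : ℝ) : Prop :=
  ∃ d : ℕ, ∀ n : ℕ, 1 ≤ n →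
    ((complexity U (firstBits α n) : ℝ≥0∞) : EReal) ≤ ((T * n + d : ℝ) : EReal)

/-- The set of strings that are compressible with respect to `V`. -/
def compressibleStrings (V : List Bool →. List Bool) : Set (List Bool) :=
  {s | complexity V s < (s.length : ℕ∞)}

/-- `CS_V(T)`, the sum of `2 ^ (-|s| / T)` over all `s` with `H_V(s) < |s|`, as a value in
`[0, ∞]`. The sum diverges to `∞` exactly when this value is `⊤`. -/
def CS (V : List Bool →. List Bool) (T : ℝ) : ℝ≥0∞ :=
  ∑' s : compressibleStrings V, ENNReal.ofReal ((2 : ℝ) ^ (-((s : List Bool).length : ℝ) / T))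

end CompressibleStrings

end

/-! Choosing for every compressible string a shorter program embeds the compressible strings into
the prefix-free domain of `V`, so Kraft's inequality bounds the sum of `2^(-|s|)` over them by
`1/2`. For `T ≤ 1` this dominates `CS V T`, and a recursive enumeration without repetitions makes
the value left-computable.

Randomness: the first `n` bits of `CS V T` tell when an enumeration has left less than `2^(1-n)` of
the sum outstanding. Each compressible string that is still missing then has length above `T(n-1)`,
so a string of length about `T n` that has not appeared is incompressible. It is computed from the
`n` bits, so by optimality of `V` their complexity is at least `T n - O(1)`.

Compressibility: for each `n`, follow the integer part of `2^n` times the growing partial sums, and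
whenever it changes request programs of length about `T n` for the few strings that fit the new
value. A weight `w` causes at most about `min(1, 2^n w)` changes at level `n`, and for `T < 1` the
sum over `n` of `2^(-T n) min(1, 2^n w)` is `O(w^T)`. Since `w = 2^(-|s|/T)`, this is `O(2^(-|s|))`:
the total request is finite by Kraft, and the Kraft–Chaitin theorem (`exists_program_of_request`)
supplies the programs.

Divergence: the `2^(a²)` strings of length `a² + 2a` that start with `2a` zeros are compressible for
large `a`, and for `T > 1` their contribution is unbounded in `a`. -/

namespace CompressibleStrings

/-! ### Closure properties of recursive functions, and unbounded search. -/

section Computability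

variable {α β : Type*} [Primcodable α] [Primcodable β]

theorem computable_add {f g : α → ℕ} (hf : Computable f) (hg : Computable g) :
    Computable fun a => f a + g a :=
  Primrec.nat_add.to_comp.comp hf hg

theorem computable_mul {f g : α → ℕ} (hf : Computable f) (hg : Computable g) :
    Computable fun a => f a * g a :=
  Primrec.nat_mul.to_comp.comp hf hg

theorem computable_sub {f g : α → ℕ} (hf : Computable f) (hg : Computable g) :
    Computable fun a => f a - g a :=
  Primrec.nat_sub.to_comp.comp hf hg

theorem computable_div {f g : α → ℕ} (hf : Computable f) (hg : Computable g) :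
    Computable fun a => f a / g a :=
  Primrec.nat_div.to_comp.comp hf hg

theorem computable_pow {f g : α → ℕ} (hf : Computable f) (hg : Computable g) :
    Computable fun a => f a ^ g a :=
  (Primrec₂.unpaired'.1 Nat.Primrec.pow).to_comp.comp hf hg

theorem computable_decide_le {f g : α → ℕ} (hf : Computable f) (hg : Computable g) :
    Computable fun a => decide (f a ≤ g a) :=
  Primrec.nat_le.decide.to_comp.comp hf hg

theorem computable_decide_lt {f g : α → ℕ} (hf : Computable f) (hg : Computable g) :
    Computable fun a => decide (f a < g a) :=
  Primrec.nat_lt.decide.to_comp.comp hf hg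

theorem computable_decide_eq [DecidableEq β] {f g : α → β} (hf : Computable f)
    (hg : Computable g) : Computable fun a => decide (f a = g a) :=
  Primrec.eq.decide.to_comp.comp hf hg

theorem computable_and {f g : α → Bool} (hf : Computable f) (hg : Computable g) :
    Computable fun a => f a && g a :=
  Primrec.and.to_comp.comp hf hg

theorem computable_or {f g : α → Bool} (hf : Computable f) (hg : Computable g) :
    Computable fun a => f a || g a :=
  Primrec.or.to_comp.comp hf hg

theorem computable_not {f : α → Bool} (hf : Computable f) : Computable fun a => !f a :=
  Primrec.not.to_comp.comp hf

theorem computable_sum_range {g : α → ℕ → ℕ} {f : α → ℕ} (hg : Computable₂ g)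
    (hf : Computable f) : Computable fun a => ∑ j ∈ Finset.range (f a), g a j := by
  have h : Computable fun a =>
      (Nat.rec 0 (fun j r => r + g a j) (f a) : ℕ) :=
    Computable.nat_rec hf (Computable.const 0)
      (h := fun a p => p.2 + g a p.1)
      (computable_add (Computable.snd.comp Computable.snd)
        (hg.comp Computable.fst (Computable.fst.comp Computable.snd)))
  refine h.of_eq fun a => ?_
  induction f a with
  | zero => simp
  | succ n ih => rw [Finset.sum_range_succ, ← ih]

/-- Unbounded search for a witness of a decidable relation. -/
theorem exists_partrec_search {P : α → β → Bool} (hP : Computable₂ P) :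
    ∃ Ψ : α →. β, Partrec Ψ ∧ (∀ x y, y ∈ Ψ x → P x y = true) ∧
      ∀ x y, P x y = true → ∃ z, z ∈ Ψ x := by
  let g : α → ℕ → Option β := fun x n =>
    (Encodable.decode (α := β) n).bind fun y => cond (P x y) (some y) none
  have hg : Computable₂ g := by
    refine Computable.option_bind (Computable.decode.comp Computable.snd) ?_
    exact Computable.cond
      (hP.comp (Computable.fst.comp Computable.fst) Computable.snd)
      (Computable.option_some.comp Computable.snd) (Computable.const none)
  refine ⟨fun x => Nat.rfindOpt (g x), Partrec.rfindOpt hg, ?_, ?_⟩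
  · intro x y hy
    obtain ⟨n, hn⟩ := Nat.rfindOpt_spec hy
    simp only [g, Option.mem_def, Option.bind_eq_some_iff] at hn
    obtain ⟨z, -, hz⟩ := hn
    cases h : P x z <;> simp [h] at hz
    rwa [← hz]
  · intro x y hy
    have : (Nat.rfindOpt (g x)).Dom :=
      Nat.rfindOpt_dom.2 ⟨Encodable.encode y, y, by simp [g, hy]⟩
    exact ⟨_, Part.get_mem this⟩

theorem exists_computable_search {P : α → β → Bool} (hP : Computable₂ P)
    (h : ∀ x, ∃ y, P x y = true) : ∃ f : α → β, Computable f ∧ ∀ x, P x (f x) = true := by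
  obtain ⟨Ψ, hΨ, h1, h2⟩ := exists_partrec_search hP
  have h3 : ∀ x, ∃ z, z ∈ Ψ x := fun x => (h x).elim fun y hy => h2 x y hy
  choose f hf using h3
  exact ⟨f, hΨ.of_eq_tot hf, fun x => h1 x _ (hf x)⟩

end Computability

/-! ### Strings as binary numerals. -/

section Binary

/-- The natural number written in base two by a string, most significant bit first. -/
def binVal (s : List Bool) : ℕ := s.foldl (fun a b => 2 * a + b.toNat) 0

theorem computable_binVal : Computable binVal := by
  refine Primrec.to_comp ?_
  refine Primrec.list_foldl (h := fun _ (p : ℕ × Bool) => 2 * p.1 + p.2.toNat) Primrec.id (Primrec.const 0) ?_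
  exact Primrec.nat_add.comp
    (Primrec.nat_mul.comp (Primrec.const 2) (Primrec.fst.comp Primrec.snd))
    ((Primrec.dom_finite Bool.toNat).comp (Primrec.snd.comp Primrec.snd))

@[simp] theorem binVal_nil : binVal [] = 0 := rfl

theorem binVal_concat (s : List Bool) (b : Bool) :
    binVal (s ++ [b]) = 2 * binVal s + b.toNat := by
  simp [binVal]

theorem binVal_append (s t : List Bool) :
    binVal (s ++ t) = binVal s * 2 ^ t.length + binVal t := by
  induction t using List.reverseRecOn with
  | nil => simp
  | append_singleton t b ih =>
    rw [← List.append_assoc, binVal_concat, ih, binVal_concat]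
    simp only [List.length_append, List.length_singleton, pow_succ]
    ring

theorem binVal_lt (s : List Bool) : binVal s < 2 ^ s.length := by
  induction s using List.reverseRecOn with
  | nil => simp
  | append_singleton s b ih =>
    rw [binVal_concat, List.length_append, List.length_singleton, pow_succ]
    have := b.toNat_le
    omega

theorem binVal_injective {s t : List Bool} (hl : s.length = t.length)
    (h : binVal s = binVal t) : s = t := by
  induction s using List.reverseRecOn generalizing t with
  | nil => exact (List.length_eq_zero_iff.1 hl.symm).symm
  | append_singleton s b ih =>
    rcases List.eq_nil_or_concat t with rfl | ⟨t, c, rfl⟩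
    · simp at hl
    · rw [List.concat_eq_append] at *
      rw [binVal_concat, binVal_concat] at h
      have hb := b.toNat_le
      have hc := c.toNat_le
      have h1 : s = t := ih (by simpa using hl) (by omega)
      have h2 : b.toNat = c.toNat := by omega
      have h3 : b = c := by cases b <;> cases c <;> simp_all
      rw [h1, h3]

theorem exists_binVal_eq (n v : ℕ) (hv : v < 2 ^ n) :
    ∃ s : List Bool, s.length = n ∧ binVal s = v := by
  induction n generalizing v with
  | zero => exact ⟨[], rfl, by simp at hv; simp [hv]⟩
  | succ n ih =>
    obtain ⟨s, hs, hv'⟩ := ih (v / 2) (by rw [pow_succ] at hv; omega)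
    refine ⟨s ++ [decide (v % 2 = 1)], by simp [hs], ?_⟩
    rw [binVal_concat, hv']
    rcases Nat.mod_two_eq_zero_or_one v with h | h <;> simp [h] <;> omega

theorem length_firstBits (α : ℝ) (n : ℕ) : (firstBits α n).length = n := by
  simp [firstBits]

/-- Halving and rounding down commute, so appending a digit refines the previous integer part. After
this, statements about bits are inequalities between naturals. -/
theorem binVal_firstBits (α : ℝ) (n : ℕ) :
    binVal (firstBits α n) = ⌊Int.fract α * 2 ^ n⌋₊ := by
  induction n with
  | zero => simp [firstBits, Nat.floor_eq_zero.2 (Int.fract_lt_one α)]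
  | succ n ih =>
    have h1 : firstBits α (n + 1) =
        firstBits α n ++ [decide (Real.digits (Int.fract α) 2 n = 1)] := by
      rw [firstBits, List.ofFn_succ_last]
      rfl
    rw [h1, binVal_concat, ih]
    set x := Int.fract α
    have h2 : ⌊x * 2 ^ n⌋₊ = ⌊x * 2 ^ (n + 1)⌋₊ / 2 := by
      rw [← Nat.floor_div_natCast, pow_succ]
      congr 1
      push_cast
      ring
    have h3 : (decide (Real.digits x 2 n = 1)).toNat = ⌊x * 2 ^ (n + 1)⌋₊ % 2 := by
      have : (Real.digits x 2 n = 1) ↔ ⌊x * 2 ^ (n + 1)⌋₊ % 2 = 1 := by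
        simp [Real.digits, Fin.ext_iff, Fin.ofNat]
      rcases Nat.mod_two_eq_zero_or_one ⌊x * 2 ^ (n + 1)⌋₊ with h | h <;> simp [this, h]
    rw [h2, h3, Nat.div_add_mod]

end Binary

/-! ### Programs and complexity. -/

section Machines

variable {C U V : List Bool →. List Bool}

theorem complexity_le {p s : List Bool} (h : s ∈ C p) : complexity C s ≤ p.length :=
  iInf₂_le p h

theorem exists_program_of_complexity_lt {s : List Bool} {n : ℕ∞} (h : complexity C s < n) :
    ∃ p, s ∈ C p ∧ (p.length : ℕ∞) < n := by
  simpa [complexity, iInf_lt_iff] using h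

theorem exists_program_of_complexity_ne_top {s : List Bool} (h : complexity C s ≠ ⊤) :
    ∃ p, s ∈ C p ∧ complexity C s = p.length := by
  obtain ⟨p, hp, hl⟩ := exists_program_of_complexity_lt
    (ENat.lt_add_one_iff h |>.2 le_rfl : complexity C s < complexity C s + 1)
  exact ⟨p, hp, le_antisymm (complexity_le hp) ((ENat.lt_add_one_iff h).1 hl)⟩

/-- Applying a partial recursive function raises the complexity by at most a constant. -/
theorem exists_program_length_le_of_partrec (hU : IsPrefixFreeMachine U)
    (hV : IsOptimalPrefixFreeMachine V) {Ψ : List Bool →. List Bool} (hΨ : Partrec Ψ) :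
    ∃ d : ℕ, ∀ p x y, x ∈ U p → y ∈ Ψ x → ∃ q, y ∈ V q ∧ q.length ≤ p.length + d := by
  obtain ⟨d, hd⟩ := hV.2 (fun p => (U p).bind Ψ)
    ⟨hU.1.bind (hΨ.comp Computable.snd), fun p hp q hq h => hU.2 p hp.1 q hq.1 h⟩
  exact ⟨d, fun p x y hx hy => hd p y (Part.mem_bind hx hy)⟩

end Machines

/-! ### The Kraft–Chaitin theorem. -/

section KraftChaitin

/-- The dyadic rational in `[0, 1)` with the given bits after the binary point. -/
noncomputable def binFrac (p : List Bool) : ℝ := binVal p / 2 ^ p.length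

/-- The dyadic interval of an extension lies inside that of the prefix, so comparable programs have
overlapping intervals. This is how prefix-freeness is obtained below. -/
theorem binFrac_append (p t : List Bool) :
    binFrac p ≤ binFrac (p ++ t) ∧
      binFrac (p ++ t) + 1 / 2 ^ (p ++ t).length ≤ binFrac p + 1 / 2 ^ p.length := by
  have h : (binVal t : ℝ) + 1 ≤ 2 ^ t.length := by exact_mod_cast binVal_lt t
  simp only [binFrac, binVal_append, List.length_append, pow_add]
  push_cast
  rw [← add_div, ← add_div, div_le_div_iff₀ (by positivity) (by positivity),
    div_le_div_iff₀ (by positivity) (by positivity)]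
  have h1 : (0 : ℝ) < 2 ^ p.length := by positivity
  constructor
  · nlinarith [(binVal t).cast_nonneg (α := ℝ)]
  · nlinarith

/-- The measure of a request: a request `(l, s)` for a program of `s` of length `l` has
measure `2 ^ (-l)`. -/
noncomputable def requestWeight (r : Option (ℕ × List Bool)) : ℝ≥0∞ := r.elim 0 fun r => 2⁻¹ ^ r.1

/-- Numerator and exponent of the denominator of a partial sum of measures of requests. -/
def requestSum (q : ℕ → Option (ℕ × List Bool)) (i : ℕ) : ℕ × ℕ :=
  Nat.rec (0, 0) (fun j x =>
    Option.casesOn (q j) x fun r => (x.1 * 2 ^ r.1 + 2 ^ x.2, x.2 + r.1)) i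

theorem computable_requestSum {q : ℕ → Option (ℕ × List Bool)} (hq : Computable q) :
    Computable (requestSum q) := by
  have hx : Computable fun p : (ℕ × ℕ × ℕ × ℕ) × ℕ × List Bool => p.1.2.2 :=
    Computable.snd.comp (Computable.snd.comp Computable.fst)
  have hl : Computable fun p : (ℕ × ℕ × ℕ × ℕ) × ℕ × List Bool => p.2.1 :=
    Computable.fst.comp Computable.snd
  have hg : Computable₂ fun (p : ℕ × ℕ × ℕ × ℕ) (r : ℕ × List Bool) =>
      (p.2.2.1 * 2 ^ r.1 + 2 ^ p.2.2.2, p.2.2.2 + r.1) :=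
    Computable.pair
      (computable_add
        (computable_mul (Computable.fst.comp hx) (computable_pow (Computable.const 2) hl))
        (computable_pow (Computable.const 2) (Computable.snd.comp hx)))
      (computable_add (Computable.snd.comp hx) hl)
  have hh : Computable₂ fun (_ : ℕ) (p : ℕ × ℕ × ℕ) =>
      (Option.casesOn (q p.1) p.2 fun r => (p.2.1 * 2 ^ r.1 + 2 ^ p.2.2, p.2.2 + r.1) : ℕ × ℕ) :=
    Computable.option_casesOn (hq.comp (Computable.fst.comp Computable.snd))
      (Computable.snd.comp Computable.snd) hg
  exact Computable.nat_rec Computable.id (Computable.const (0, 0)) hh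

theorem requestSum_div (q : ℕ → Option (ℕ × List Bool)) (i : ℕ) :
    ((requestSum q i).1 : ℝ) / 2 ^ (requestSum q i).2 =
      ∑ j ∈ Finset.range i, (requestWeight (q j)).toReal := by
  induction i with
  | zero => simp [requestSum]
  | succ i ih =>
    rw [Finset.sum_range_succ, ← ih]
    have h : requestSum q (i + 1) = Option.casesOn (q i) (requestSum q i) fun r =>
      ((requestSum q i).1 * 2 ^ r.1 + 2 ^ (requestSum q i).2, (requestSum q i).2 + r.1) := rfl
    rw [h]
    rcases q i with - | ⟨l, s⟩
    · simp [requestWeight]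
    · simp [requestWeight, pow_add]
      field_simp

/-- The Kraft–Chaitin theorem, up to an additive constant, for requests of total measure at
most `1`. -/
theorem exists_program_of_request_aux {U : List Bool →. List Bool}
    (hU : IsOptimalPrefixFreeMachine U) {q : ℕ → Option (ℕ × List Bool)} (hq : Computable q)
    (hs : ∑' i, requestWeight (q i) ≤ 1) :
    ∃ d : ℕ, ∀ i l s, q i = some (l, s) → ∃ p, s ∈ U p ∧ p.length ≤ l + d := by
  set X : ℕ → ℝ := fun i => ∑ j ∈ Finset.range i, (requestWeight (q j)).toReal with hX
  have hXmono : Monotone X := fun i j hij =>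
    Finset.sum_le_sum_of_subset_of_nonneg (Finset.range_mono hij) fun _ _ _ =>
      ENNReal.toReal_nonneg
  have hX0 : ∀ i, 0 ≤ X i := fun i => Finset.sum_nonneg fun _ _ => ENNReal.toReal_nonneg
  have hfin : ∀ i, requestWeight (q i) ≠ ⊤ := fun i =>
    ((ENNReal.le_tsum i).trans hs).trans_lt ENNReal.one_lt_top |>.ne
  have hX1 : ∀ i, X i ≤ 1 := fun i => by
    rw [hX]
    simp only
    rw [← ENNReal.toReal_sum fun j _ => hfin j]
    exact ENNReal.toReal_le_of_le_ofReal zero_le_one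
      (by simpa using (ENNReal.sum_le_tsum _).trans hs)
  have hXs : ∀ i l s, q i = some (l, s) → X (i + 1) = X i + 1 / 2 ^ l := by
    intro i l s h
    simp [hX, Finset.sum_range_succ, h, requestWeight]
  -- The `i`-th request owns the interval from `X i` to `X (i + 1)`, of length `2^(-l)`. Every
  -- string `p` of length `l + 1` whose dyadic interval fits inside it serves as a program; the test
  -- is exact integer arithmetic.
  let P : List Bool → ℕ × ℕ × List Bool → Bool := fun p y =>
    (decide (q y.1 = some y.2) && decide (p.length = y.2.1 + 1)) &&
    (decide ((requestSum q y.1).1 * 2 ^ p.length ≤ binVal p * 2 ^ (requestSum q y.1).2) &&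
      decide ((binVal p + 1) * 2 ^ (requestSum q (y.1 + 1)).2 ≤
        (requestSum q (y.1 + 1)).1 * 2 ^ p.length))
  have hP : Computable₂ P := by
    have hi : Computable fun z : List Bool × ℕ × ℕ × List Bool => z.2.1 :=
      Computable.fst.comp Computable.snd
    have hr : Computable fun z : List Bool × ℕ × ℕ × List Bool => z.2.2 :=
      Computable.snd.comp Computable.snd
    have hl : Computable fun z : List Bool × ℕ × ℕ × List Bool => z.1.length :=
      Computable.list_length.comp Computable.fst
    have hv : Computable fun z : List Bool × ℕ × ℕ × List Bool => binVal z.1 :=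
      computable_binVal.comp Computable.fst
    have hS := (computable_requestSum hq).comp hi
    have hS' := (computable_requestSum hq).comp (Computable.succ.comp hi)
    have h2 : Computable fun _ : List Bool × ℕ × ℕ × List Bool => 2 := Computable.const 2
    exact computable_and
      (computable_and
        (computable_decide_eq (hq.comp hi) (Computable.option_some.comp hr))
        (computable_decide_eq hl (Computable.succ.comp (Computable.fst.comp hr))))
      (computable_and
        (computable_decide_le
          (computable_mul (Computable.fst.comp hS) (computable_pow h2 hl))
          (computable_mul hv (computable_pow h2 (Computable.snd.comp hS))))
        (computable_decide_le
          (computable_mul (Computable.succ.comp hv) (computable_pow h2 (Computable.snd.comp hS')))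
          (computable_mul (Computable.fst.comp hS') (computable_pow h2 hl))))
  have hPiff : ∀ p i l s, P p (i, l, s) = true ↔ q i = some (l, s) ∧ p.length = l + 1 ∧
      X i ≤ binFrac p ∧ binFrac p + 1 / 2 ^ p.length ≤ X (i + 1) := by
    intro p i l s
    simp only [P, Bool.and_eq_true, decide_eq_true_eq, and_assoc, hX, ← requestSum_div, binFrac]
    rw [← add_div, div_le_div_iff₀ (by positivity) (by positivity),
      div_le_div_iff₀ (by positivity) (by positivity)]
    norm_cast
  have hdisj : ∀ p t i r i' r', P p (i, r) = true → P (p ++ t) (i', r') = true → i = i' := by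
    rintro p t i ⟨l, s⟩ i' ⟨l', s'⟩ h h'
    rw [hPiff] at h h'
    obtain ⟨-, -, h1, h2⟩ := h
    obtain ⟨-, -, h3, h4⟩ := h'
    obtain ⟨h5, h6⟩ := binFrac_append p t
    have h7 : (0 : ℝ) < 1 / 2 ^ (p ++ t).length := by positivity
    rcases lt_trichotomy i i' with hlt | heq | hlt
    · have := hXmono (Nat.succ_le_of_lt hlt)
      simp only [Nat.succ_eq_add_one] at this
      linarith
    · exact heq
    · have := hXmono (Nat.succ_le_of_lt hlt)
      simp only [Nat.succ_eq_add_one] at this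
      linarith
  obtain ⟨Ψ, hΨ, hΨ1, hΨ2⟩ := exists_partrec_search hP
  obtain ⟨d, hd⟩ := hU.2 (fun p => (Ψ p).map fun y => y.2.2)
    ⟨hΨ.map (Computable.snd.comp (Computable.snd.comp Computable.snd)).to₂, by
      intro p hp p' hp' hpre
      obtain ⟨⟨i, l, s⟩, hy⟩ := Part.dom_iff_mem.1 (show (Ψ p).Dom from hp)
      obtain ⟨⟨i', l', s'⟩, hy'⟩ := Part.dom_iff_mem.1 (show (Ψ p').Dom from hp')
      obtain ⟨t, rfl⟩ := hpre
      have h1 := hΨ1 _ _ hy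
      have h2 := hΨ1 _ _ hy'
      have h3 := hdisj _ _ _ _ _ _ h1 h2
      subst h3
      rw [hPiff] at h1 h2
      have h4 := h1.1.symm.trans h2.1
      simp only [Option.some.injEq, Prod.mk.injEq] at h4
      have h5 : (p ++ t).length = p.length := by rw [h1.2.1, h2.2.1, h4.1]
      have h6 : t = [] := by simpa using h5
      simp [h6]⟩
  -- The extra bit: an interval of length `2^(-l)` need not be aligned, but it always contains an
  -- aligned dyadic interval of half its length, the one starting at the first multiple of
  -- `2^(-(l+1))` from `X i` on.
  refine ⟨d + 1, fun i l s h => ?_⟩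
  have hstep := hXs i l s h
  have hle := hX1 (i + 1)
  have hpow : (2 : ℝ) ^ (l + 1) * (1 / 2 ^ l) = 2 := by rw [pow_succ]; field_simp
  have hceil := Nat.ceil_lt_add_one (a := X i * 2 ^ (l + 1)) (mul_nonneg (hX0 i) (by positivity))
  have hceil' := Nat.le_ceil (X i * 2 ^ (l + 1))
  set v := ⌈X i * 2 ^ (l + 1)⌉₊
  have hv1 : (v : ℝ) + 1 ≤ X (i + 1) * 2 ^ (l + 1) := by rw [hstep]; nlinarith
  have hv2 : v < 2 ^ (l + 1) := by
    have : (v : ℝ) + 1 ≤ 2 ^ (l + 1) :=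
      hv1.trans (mul_le_of_le_one_left (by positivity) hle)
    exact_mod_cast this
  obtain ⟨p, hpl, hpv⟩ := exists_binVal_eq _ _ hv2
  have hPp : P p (i, l, s) = true := by
    rw [hPiff, binFrac, hpl, hpv, ← add_div, le_div_iff₀ (by positivity),
      div_le_iff₀ (by positivity)]
    exact ⟨h, rfl, hceil', hv1⟩
  obtain ⟨⟨i', l', s'⟩, hz⟩ := hΨ2 _ _ hPp
  -- The search may return another witness, but disjointness with the empty extension forces the
  -- same request.
  have h3 : i = i' := hdisj p [] i _ i' _ hPp (by simpa using hΨ1 _ _ hz)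
  have h4 := ((hPiff _ _ _ _).1 (hΨ1 _ _ hz)).1
  rw [← h3, h] at h4
  simp only [Option.some.injEq, Prod.mk.injEq] at h4
  obtain ⟨p', hp', hl'⟩ := hd p s (by
    rw [h4.2]
    exact Part.mem_map (fun y : ℕ × ℕ × List Bool => y.2.2) hz)
  exact ⟨p', hp', by omega⟩

/-- The Kraft–Chaitin theorem, up to an additive constant. -/
theorem exists_program_of_request {U : List Bool →. List Bool}
    (hU : IsOptimalPrefixFreeMachine U) {q : ℕ → Option (ℕ × List Bool)} (hq : Computable q)
    (hs : ∑' i, requestWeight (q i) ≠ ⊤) :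
    ∃ d : ℕ, ∀ i l s, q i = some (l, s) → ∃ p, s ∈ U p ∧ p.length ≤ l + d := by
  -- Lengthening all requests by `D` divides the total measure by `2^D ≥ D`, which brings it down to
  -- at most `1`.
  obtain ⟨D, hD⟩ := ENNReal.exists_nat_gt hs
  obtain ⟨d, hd⟩ := exists_program_of_request_aux hU
    (q := fun i => (q i).map fun r => (r.1 + D, r.2))
    (Computable.option_map hq (Computable.pair
      (computable_add (Computable.fst.comp Computable.snd) (Computable.const D))
      (Computable.snd.comp Computable.snd))) (by
    have h : ∀ i, requestWeight ((q i).map fun r => (r.1 + D, r.2)) =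
        requestWeight (q i) * 2⁻¹ ^ D := by
      intro i
      rcases q i with - | ⟨l, s⟩ <;> simp [requestWeight, pow_add]
    simp_rw [h]
    rw [ENNReal.tsum_mul_right]
    have hD2 : (D : ℝ≥0∞) ≤ 2 ^ D := by exact_mod_cast D.lt_two_pow_self.le
    calc _ ≤ (2 : ℝ≥0∞) ^ D * 2⁻¹ ^ D := mul_le_mul_left (hD.le.trans hD2) _
      _ = 1 := by rw [← mul_pow, ENNReal.mul_inv_cancel (by simp) (by simp), one_pow])
  refine ⟨D + d, fun i l s h => ?_⟩
  obtain ⟨p, hp, hl⟩ := hd i (l + D) s (by simp [h])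
  exact ⟨p, hp, by omega⟩

end KraftChaitin

/-! ### Kraft's inequality and counting compressible strings. -/

section Kraft

/-- The first codewords of two factorisations of one word are prefixes of that word, hence
comparable, hence equal; cancel them and induct. The set `{[]}` is prefix-free but not uniquely
decodable, so the empty word is excluded. -/
theorem PrefixFree.uniquelyDecodable {S : Set (List Bool)} (hS : PrefixFree S) (h0 : [] ∉ S) :
    InformationTheory.UniquelyDecodable S := by
  intro L₁
  induction L₁ with
  | nil =>
    intro L₂ _ h2 h
    rcases L₂ with - | ⟨w, L₂⟩
    · rfl
    · have : w = [] := by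
        have := h.symm
        simp only [List.flatten_nil, List.flatten_cons, List.append_eq_nil_iff] at this
        exact this.1
      exact absurd (h2 w (by simp)) (this ▸ h0)
  | cons v L₁ ih =>
    intro L₂ h1 h2 h
    rcases L₂ with - | ⟨w, L₂⟩
    · have : v = [] := by
        simp only [List.flatten_nil, List.flatten_cons, List.append_eq_nil_iff] at h
        exact h.1
      exact absurd (h1 v (by simp)) (this ▸ h0)
    · have hv := h1 v (by simp)
      have hw := h2 w (by simp)
      simp only [List.flatten_cons] at h
      have hvw : v = w := by
        rcases List.prefix_or_prefix_of_prefix (List.prefix_append v L₁.flatten)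
          (h ▸ List.prefix_append w L₂.flatten) with h' | h'
        · exact hS v hv w hw h'
        · exact (hS w hw v hv h').symm
      subst hvw
      rw [ih L₂ (fun x hx => h1 x (by simp [hx])) (fun x hx => h2 x (by simp [hx]))
        (List.append_cancel_left h)]

/-- Kraft's inequality. -/
theorem PrefixFree.tsum_le_one {S : Set (List Bool)} (hS : PrefixFree S) :
    ∑' p : S, (2⁻¹ : ℝ≥0∞) ^ (p : List Bool).length ≤ 1 := by
  by_cases h0 : [] ∈ S
  · have hS0 : S = {[]} := by
      ext p
      simp only [Set.mem_singleton_iff]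
      exact ⟨fun hp => (hS _ h0 _ hp List.nil_prefix).symm, fun h => h ▸ h0⟩
    subst hS0
    rw [tsum_singleton ([] : List Bool) fun p => (2⁻¹ : ℝ≥0∞) ^ p.length]
    simp
  · rw [ENNReal.tsum_eq_iSup_sum]
    refine iSup_le fun F => ?_
    have hF : ∀ p ∈ F.map (Function.Embedding.subtype _), p ∈ S := by
      intro p hp
      obtain ⟨x, -, rfl⟩ := Finset.mem_map.1 hp
      exact x.2
    have hpf : PrefixFree (F.map (Function.Embedding.subtype _) : Finset (List Bool)) :=
      fun p hp q hq h => hS p (hF p hp) q (hF q hq) h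
    have h := InformationTheory.kraft_mcmillan_inequality
      (hpf.uniquelyDecodable fun h => h0 (hF _ h))
    rw [Finset.sum_map] at h
    simp only [Fintype.card_bool, Function.Embedding.subtype_apply] at h
    have h2 : ∀ n : ℕ, (2⁻¹ : ℝ≥0∞) ^ n = ENNReal.ofReal ((1 / 2) ^ n) := by
      intro n
      rw [ENNReal.ofReal_pow (by norm_num), one_div, ENNReal.ofReal_inv_of_pos (by norm_num)]
      simp
    simp_rw [h2]
    rw [← ENNReal.ofReal_sum_of_nonneg fun _ _ => by positivity, ← ENNReal.ofReal_one]
    exact ENNReal.ofReal_le_ofReal (by simpa using h)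

/-- A shorter program determines its string, so this is Kraft's inequality on the domain of `V`; the
saved bit gives the factor `1/2`. Being strictly below `1` matters both for `exists_incompressible`
and for the integer part of `CS V T`. -/
theorem tsum_compressibleStrings_le {V : List Bool →. List Bool} (hV : IsPrefixFreeMachine V) :
    ∑' s : compressibleStrings V, (2⁻¹ : ℝ≥0∞) ^ (s : List Bool).length ≤ 2⁻¹ := by
  have h : ∀ s : compressibleStrings V, ∃ p, (s : List Bool) ∈ V p ∧
      p.length < (s : List Bool).length := fun s => by
    obtain ⟨p, hp, hl⟩ := exists_program_of_complexity_lt s.2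
    exact ⟨p, hp, by exact_mod_cast hl⟩
  choose f hf hl using h
  have hdom : ∀ s, f s ∈ V.Dom := fun s => Part.dom_iff_mem.2 ⟨_, hf s⟩
  have hinj : Function.Injective fun s => (⟨f s, hdom s⟩ : V.Dom) := by
    intro s t hst
    have h1 : f s = f t := congrArg Subtype.val hst
    have h2 := hf s
    rw [h1] at h2
    exact Subtype.ext (Part.mem_unique h2 (hf t))
  calc ∑' s : compressibleStrings V, (2⁻¹ : ℝ≥0∞) ^ (s : List Bool).length
      ≤ ∑' s : compressibleStrings V, 2⁻¹ * (2⁻¹ : ℝ≥0∞) ^ (f s).length := by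
        refine ENNReal.tsum_le_tsum fun s => ?_
        rw [← pow_succ']
        exact pow_le_pow_of_le_one (by simp) (by simp) (hl s)
    _ = 2⁻¹ * ∑' s : compressibleStrings V, (2⁻¹ : ℝ≥0∞) ^ (f s).length := ENNReal.tsum_mul_left
    _ ≤ 2⁻¹ * ∑' p : V.Dom, (2⁻¹ : ℝ≥0∞) ^ (p : List Bool).length := by
        gcongr
        exact ENNReal.tsum_comp_le_tsum_of_injective hinj
          fun p : V.Dom => (2⁻¹ : ℝ≥0∞) ^ (p : List Bool).length
    _ ≤ 2⁻¹ * 1 := by gcongr; exact hV.2.tsum_le_one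
    _ = 2⁻¹ := mul_one _

/-- The strings of length `n` whose value is less than `v`. -/
theorem exists_finset_binVal_lt (n v : ℕ) (hv : v ≤ 2 ^ n) :
    ∃ F : Finset (List Bool), F.card = v ∧ ∀ s ∈ F, s.length = n ∧ binVal s < v := by
  have h : ∀ i : Fin v, ∃ s : List Bool, s.length = n ∧ binVal s = i :=
    fun i => exists_binVal_eq n i (i.2.trans_le hv)
  choose f hf1 hf2 using h
  have hinj : Function.Injective f := fun i j hij => Fin.ext (by rw [← hf2, hij, hf2])
  refine ⟨Finset.univ.map ⟨f, hinj⟩, by simp, ?_⟩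
  intro s hs
  obtain ⟨i, -, rfl⟩ := Finset.mem_map.1 hs
  exact ⟨hf1 i, by simp [hf2]⟩

theorem card_mul_le_tsum_compressibleStrings {V : List Bool →. List Bool} (F : Finset (List Bool))
    (g : List Bool → ℝ≥0∞) (c : ℝ≥0∞) (hF : ∀ s ∈ F, s ∈ compressibleStrings V ∧ c ≤ g s) :
    F.card * c ≤ ∑' s : compressibleStrings V, g s := by
  classical
  calc F.card * c = ∑ s ∈ F, c := by simp
    _ ≤ ∑ s ∈ F, (compressibleStrings V).indicator g s :=
        Finset.sum_le_sum fun s hs => by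
          rw [Set.indicator_of_mem (hF s hs).1]
          exact (hF s hs).2
    _ ≤ ∑' s, (compressibleStrings V).indicator g s := ENNReal.sum_le_tsum F
    _ = _ := (tsum_subtype _ g).symm

/-- All strings of one length together contribute `1`, more than the `1/2` available to compressible
ones. -/
theorem exists_incompressible {V : List Bool →. List Bool} (hV : IsPrefixFreeMachine V) (n : ℕ) :
    ∃ s : List Bool, s.length = n ∧ s ∉ compressibleStrings V := by
  by_contra! h
  obtain ⟨F, hc, hF⟩ := exists_finset_binVal_lt n (2 ^ n) le_rfl
  have h1 := card_mul_le_tsum_compressibleStrings (V := V) F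
    (fun s => (2⁻¹ : ℝ≥0∞) ^ s.length) (2⁻¹ ^ n)
    fun s hs => ⟨h s (hF s hs).1, by rw [(hF s hs).1]⟩
  have h2 := h1.trans (tsum_compressibleStrings_le hV)
  rw [hc] at h2
  push_cast at h2
  rw [← mul_pow, ENNReal.mul_inv_cancel (by simp) (by simp), one_pow] at h2
  simp at h2

end Kraft

/-! ### Recursive enumeration of the compressible strings. -/

section Enumeration

/-- A recursive enumeration without repetitions of the compressible strings. -/
theorem exists_enumeration {V : List Bool →. List Bool} (hV : Partrec V) :
    ∃ e : ℕ → Option (List Bool), Computable e ∧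
      (∀ s, s ∈ compressibleStrings V ↔ ∃ k, e k = some s) ∧
      ∀ i j s, e i = some s → e j = some s → i = j := by
  obtain ⟨c, hc⟩ := Nat.Partrec.Code.exists_code.1 hV
  have hcV : ∀ p s, s ∈ V p ↔ ∃ k, Nat.Partrec.Code.evaln k c (Encodable.encode p) =
      some (Encodable.encode s) := by
    intro p s
    have := Nat.Partrec.Code.evaln_complete (c := c) (n := Encodable.encode p)
      (x := Encodable.encode s)
    rw [hc] at this
    simpa using this
  let Q : ℕ × List Bool × List Bool → Bool := fun y =>
    decide (Nat.Partrec.Code.evaln y.1 c (Encodable.encode y.2.1) =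
      some (Encodable.encode y.2.2)) && decide (y.2.1.length < y.2.2.length)
  have hQ : Computable Q := by
    have hp : Computable fun y : ℕ × List Bool × List Bool => y.2.1 :=
      Computable.fst.comp Computable.snd
    have hs : Computable fun y : ℕ × List Bool × List Bool => y.2.2 :=
      Computable.snd.comp Computable.snd
    exact computable_and
      (computable_decide_eq
        (Nat.Partrec.Code.primrec_evaln.to_comp.comp
          (Computable.pair (Computable.pair Computable.fst (Computable.const c))
            (Computable.encode.comp hp)))
        (Computable.option_some.comp (Computable.encode.comp hs)))
      (computable_decide_lt (Computable.list_length.comp hp) (Computable.list_length.comp hs))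
  let e₀ : ℕ → Option (List Bool) := fun i =>
    (Encodable.decode (α := ℕ × List Bool × List Bool) i).bind fun y =>
      cond (Q y) (some y.2.2) none
  have he₀ : Computable e₀ :=
    Computable.option_bind Computable.decode
      (Computable.cond (hQ.comp Computable.snd)
        (Computable.option_some.comp
          (Computable.snd.comp (Computable.snd.comp Computable.snd))) (Computable.const none))
  have hmem : ∀ s, s ∈ compressibleStrings V ↔ ∃ k, e₀ k = some s := by
    intro s
    constructor
    · intro h
      obtain ⟨p, hp, hl⟩ := exists_program_of_complexity_lt h
      obtain ⟨k, hk⟩ := (hcV p s).1 hp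
      refine ⟨Encodable.encode (k, p, s), ?_⟩
      have hl' : p.length < s.length := by exact_mod_cast hl
      simp [e₀, Q, hk, hl']
    · rintro ⟨i, hi⟩
      simp only [e₀, Option.bind_eq_some_iff] at hi
      obtain ⟨⟨k, p, t⟩, -, h⟩ := hi
      cases hq : Q (k, p, t) <;> simp only [hq, cond_false, cond_true, reduceCtorEq,
        Option.some.injEq] at h
      subst h
      simp only [Q, Bool.and_eq_true, decide_eq_true_eq] at hq
      refine (complexity_le ((hcV p t).2 ⟨k, hq.1⟩)).trans_lt ?_
      exact_mod_cast hq.2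
  -- Counts the earlier occurrences of the `i`-th output; only outputs with count zero are kept.
  let N : ℕ → ℕ := fun i => ∑ j ∈ Finset.range i, cond (decide (e₀ j = e₀ i)) 1 0
  have hN : Computable N :=
    computable_sum_range
      (Computable.cond (computable_decide_eq (he₀.comp Computable.snd) (he₀.comp Computable.fst))
        (Computable.const 1) (Computable.const 0)) Computable.id
  have hN0 : ∀ i, N i = 0 ↔ ∀ j < i, e₀ j ≠ e₀ i := by
    intro i
    simp [N, cond_eq_ite]
  refine ⟨fun i => cond (decide (N i = 0)) (e₀ i) none,
    Computable.cond (computable_decide_eq hN (Computable.const 0)) he₀ (Computable.const none),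
    fun s => ?_, fun i j s hi hj => ?_⟩
  · rw [hmem]
    constructor
    · intro h
      classical
      refine ⟨Nat.find h, ?_⟩
      have h1 : N (Nat.find h) = 0 := (hN0 _).2 fun j hj he =>
        Nat.find_min h hj (he.trans (Nat.find_spec h))
      simp [h1, Nat.find_spec h]
    · rintro ⟨k, hk⟩
      by_cases h : N k = 0
      · exact ⟨k, by simpa [h] using hk⟩
      · simp [h] at hk
  · by_cases h1 : N i = 0
    · by_cases h2 : N j = 0
      · simp only [h1, h2, decide_true, cond_true] at hi hj
        rw [hN0] at h1 h2
        rcases lt_trichotomy i j with h | h | h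
        · exact absurd (hi.trans hj.symm) (h2 i h)
        · exact h
        · exact absurd (hj.trans hi.symm) (h1 j h)
      · simp [h2] at hj
    · simp [h1] at hi

theorem tsum_enumeration {S : Set (List Bool)} {e : ℕ → Option (List Bool)}
    (he : ∀ s, s ∈ S ↔ ∃ k, e k = some s) (hinj : ∀ i j s, e i = some s → e j = some s → i = j)
    (g : List Bool → ℝ≥0∞) : ∑' k, (e k).elim 0 g = ∑' s : S, g s := by
  choose k hk using fun s : S => (he s).1 s.2
  have hkinj : Function.Injective k := fun s t h => by
    have h1 := hk s
    rw [h, hk t] at h1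
    exact (Subtype.ext (Option.some.inj h1)).symm
  have hsupp : Function.support (fun k => (e k).elim 0 g) ⊆ Set.range k := by
    intro i hi
    rcases h : e i with - | s
    · simp [h] at hi
    · exact ⟨⟨s, (he s).2 ⟨i, h⟩⟩, hinj _ _ s (hk _) h⟩
  rw [← hkinj.tsum_eq hsupp]
  simp [hk]

end Enumeration

/-! ### Rational approximation of `T` and of `2^(-m/T)`. -/

section Approximation

open Filter Topology

variable {T : ℝ}

theorem exists_rational_bounds (hT : ComputableReal T) (h0 : 0 < T) :
    ∃ u u' v : ℕ → ℕ, Computable u ∧ Computable u' ∧ Computable v ∧ ∀ n, 1 ≤ n →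
      0 < v n ∧ (u n / v n : ℝ) < T ∧ T < (u' n / v n : ℝ) ∧
        T - 2 / n < (u n / v n : ℝ) ∧ (u' n / v n : ℝ) < T + 2 / n := by
  obtain ⟨f, ⟨a, b, c, ha, hb, hc, hf⟩, hfT⟩ := hT
  have hc1 : Computable fun n => c n + 1 := Computable.succ.comp hc
  -- The bounds are `f n - 1/n` and `f n + 1/n` over a common denominator. Truncation at zero keeps
  -- the lower one below `T` because `T > 0`, and never affects the upper one.
  refine ⟨fun n => a n * n - (b n * n + (c n + 1)), fun n => a n * n + (c n + 1) - b n * n,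
    fun n => (c n + 1) * n,
    computable_sub (computable_mul ha Computable.id)
      (computable_add (computable_mul hb Computable.id) hc1),
    computable_sub (computable_add (computable_mul ha Computable.id) hc1)
      (computable_mul hb Computable.id),
    computable_mul hc1 Computable.id, fun n hn => ?_⟩
  have hn0 : (0 : ℝ) < n := by exact_mod_cast hn
  have hc0 : (0 : ℝ) < (c n : ℝ) + 1 := by positivity
  have hv : (0 : ℝ) < ((c n : ℝ) + 1) * n := by positivity
  have h1 := abs_lt.1 (hfT n hn)
  have hfn : (f n : ℝ) = (a n - b n) / (c n + 1) := by rw [hf]; push_cast; rfl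
  have hlow : ((a n : ℝ) * n - (b n * n + (c n + 1))) / ((c n + 1) * n) = f n - 1 / n := by
    rw [hfn]; field_simp; ring
  have hupp : ((a n : ℝ) * n + (c n + 1) - b n * n) / ((c n + 1) * n) = f n + 1 / n := by
    rw [hfn]; field_simp; ring
  have h2n : (2 : ℝ) / n = 1 / n + 1 / n := by ring
  have hu' : b n * n ≤ a n * n + (c n + 1) := by
    have : (0 : ℝ) < (a n * n + (c n + 1) - b n * n) := by
      have h : (0 : ℝ) < ((a n : ℝ) * n + (c n + 1) - b n * n) / ((c n + 1) * n) := by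
        rw [hupp]; linarith
      exact (div_pos_iff_of_pos_right hv).1 h
    have h : (b n * n : ℝ) ≤ a n * n + (c n + 1) := by linarith
    exact_mod_cast h
  beta_reduce
  refine ⟨by positivity, ?_, ?_, ?_, ?_⟩
  · rcases le_total (b n * n + (c n + 1)) (a n * n) with h | h
    · push_cast [Nat.cast_sub h]
      rw [hlow]; linarith
    · rw [Nat.sub_eq_zero_of_le h]
      simpa using h0
  · push_cast [Nat.cast_sub hu']
    rw [hupp]; linarith
  · rcases le_total (b n * n + (c n + 1)) (a n * n) with h | h
    · push_cast [Nat.cast_sub h]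
      rw [hlow]; linarith
    · rw [Nat.sub_eq_zero_of_le h]
      have h3 : ((a n : ℝ) * n - (b n * n + (c n + 1))) / ((c n + 1) * n) ≤ 0 :=
        div_nonpos_of_nonpos_of_nonneg (by
          have : (a n * n : ℝ) ≤ b n * n + (c n + 1) := by exact_mod_cast h
          linarith) hv.le
      rw [hlow] at h3
      simp only [Nat.cast_zero, zero_div]
      linarith
  · push_cast [Nat.cast_sub hu']
    rw [hupp]; linarith

/-- A recursive function which differs from `n ↦ T n` by a bounded amount. -/
theorem exists_computable_near_mul (hT : ComputableReal T) (h0 : 0 < T) :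
    ∃ L : ℕ → ℕ, Computable L ∧ ∀ n, T * n - 1 ≤ L n ∧ (L n : ℝ) ≤ T * n + 2 := by
  obtain ⟨u, u', v, -, hu', hv, h⟩ := exists_rational_bounds hT h0
  refine ⟨fun n => n * u' n / v n,
    computable_div (computable_mul Computable.id hu') hv, fun n => ?_⟩
  rcases Nat.eq_zero_or_pos n with rfl | hn
  · simp
  · obtain ⟨hv0, -, h1, -, h2⟩ := h n hn
    have hn0 : (0 : ℝ) < n := by exact_mod_cast hn
    have h3 : ((n * u' n / v n : ℕ) : ℝ) ≤ n * (u' n / v n : ℝ) := by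
      refine Nat.cast_div_le.trans_eq ?_
      push_cast
      ring
    have h4 : n * (u' n / v n : ℝ) < ((n * u' n / v n : ℕ) : ℝ) + 1 := by
      have := Nat.lt_floor_add_one (((n * u' n : ℕ) : ℝ) / v n)
      rw [Nat.floor_div_natCast, Nat.floor_natCast] at this
      refine lt_of_eq_of_lt ?_ this
      push_cast
      ring
    have h5 : n * T < n * (u' n / v n : ℝ) := by gcongr
    have h6 : n * (u' n / v n : ℝ) < n * (T + 2 / n) := by gcongr
    have h7 : n * (T + 2 / n) = T * n + 2 := by field_simp
    exact ⟨by linarith, by linarith⟩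

/-- Clears a rational exponent, so that comparing the power with a dyadic rational becomes a
decidable inequality between naturals. -/
theorem two_rpow_neg_div_pow (m u v : ℕ) (hu : 0 < u) :
    ((2 : ℝ) ^ (-(m : ℝ) / ((u : ℝ) / v))) ^ u = 1 / 2 ^ (m * v) := by
  have hu' : (u : ℝ) ≠ 0 := by positivity
  rw [← Real.rpow_natCast, ← Real.rpow_mul (by norm_num), one_div, ← Real.rpow_natCast,
    ← Real.rpow_neg (by norm_num)]
  congr 1
  push_cast
  rw [div_div_eq_mul_div]
  field_simp

theorem div_le_two_rpow_iff (m u v b k : ℕ) (hu : 0 < u) :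
    (b / 2 ^ k : ℝ) ≤ 2 ^ (-(m : ℝ) / ((u : ℝ) / v)) ↔ b ^ u * 2 ^ (m * v) ≤ 2 ^ (k * u) := by
  rw [← pow_le_pow_iff_left₀ (by positivity) (by positivity) hu.ne', two_rpow_neg_div_pow m u v hu,
    div_pow, div_le_div_iff₀ (by positivity) (by positivity), one_mul, ← pow_mul]
  norm_cast

theorem two_rpow_le_div_iff (m u v b k : ℕ) (hu : 0 < u) :
    2 ^ (-(m : ℝ) / ((u : ℝ) / v)) ≤ (b / 2 ^ k : ℝ) ↔ 2 ^ (k * u) ≤ b ^ u * 2 ^ (m * v) := by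
  rw [← pow_le_pow_iff_left₀ (by positivity) (by positivity) hu.ne', two_rpow_neg_div_pow m u v hu,
    div_pow, div_le_div_iff₀ (by positivity) (by positivity), one_mul, ← pow_mul]
  norm_cast

theorem two_rpow_neg_div_mono (m : ℕ) {t t' : ℝ} (ht : 0 < t) (h : t ≤ t') :
    (2 : ℝ) ^ (-(m : ℝ) / t) ≤ 2 ^ (-(m : ℝ) / t') := by
  refine Real.rpow_le_rpow_of_exponent_le (by norm_num) ?_
  rw [neg_div, neg_div, neg_le_neg_iff]
  gcongr

/-- The reals `2 ^ (-m / T)` are computable uniformly in `m`. -/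
theorem exists_computable_near_rpow (hT : ComputableReal T) (h0 : 0 < T) :
    ∃ W : ℕ → ℕ → ℕ, Computable₂ W ∧ ∀ m k,
      (W m k / 2 ^ k : ℝ) ≤ 2 ^ (-(m : ℝ) / T) ∧
        (2 : ℝ) ^ (-(m : ℝ) / T) ≤ (W m k + 2) / 2 ^ k := by
  obtain ⟨u, u', v, hu, hu', hv, h⟩ := exists_rational_bounds hT h0
  let P : ℕ × ℕ → ℕ × ℕ → Bool := fun x y =>
    (decide (1 ≤ y.2) && decide (0 < u y.2)) &&
      (decide (y.1 ^ u y.2 * 2 ^ (x.1 * v y.2) ≤ 2 ^ (x.2 * u y.2)) &&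
        decide (2 ^ (x.2 * u' y.2) ≤ (y.1 + 2) ^ u' y.2 * 2 ^ (x.1 * v y.2)))
  have hP : Computable₂ P := by
    have hm : Computable fun z : (ℕ × ℕ) × ℕ × ℕ => z.1.1 := Computable.fst.comp Computable.fst
    have hk : Computable fun z : (ℕ × ℕ) × ℕ × ℕ => z.1.2 := Computable.snd.comp Computable.fst
    have hb : Computable fun z : (ℕ × ℕ) × ℕ × ℕ => z.2.1 := Computable.fst.comp Computable.snd
    have hn : Computable fun z : (ℕ × ℕ) × ℕ × ℕ => z.2.2 := Computable.snd.comp Computable.snd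
    have h2 : Computable fun _ : (ℕ × ℕ) × ℕ × ℕ => 2 := Computable.const 2
    exact computable_and
      (computable_and (computable_decide_le (Computable.const 1) hn)
        (computable_decide_lt (Computable.const 0) (hu.comp hn)))
      (computable_and
        (computable_decide_le
          (computable_mul (computable_pow hb (hu.comp hn))
            (computable_pow h2 (computable_mul hm (hv.comp hn))))
          (computable_pow h2 (computable_mul hk (hu.comp hn))))
        (computable_decide_le (computable_pow h2 (computable_mul hk (hu'.comp hn)))
          (computable_mul (computable_pow (computable_add hb h2) (hu'.comp hn))
            (computable_pow h2 (computable_mul hm (hv.comp hn))))))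
  have hu'pos : ∀ n, 1 ≤ n → 0 < u' n := fun n hn => by
    obtain ⟨hv0, -, h1, -⟩ := h n hn
    by_contra h2
    simp only [not_lt, Nat.le_zero] at h2
    rw [h2, Nat.cast_zero, zero_div] at h1
    linarith
  have hPiff : ∀ m k b n, P (m, k) (b, n) = true ↔ 1 ≤ n ∧ 0 < u n ∧
      (b / 2 ^ k : ℝ) ≤ 2 ^ (-(m : ℝ) / ((u n : ℝ) / v n)) ∧
      (2 : ℝ) ^ (-(m : ℝ) / ((u' n : ℝ) / v n)) ≤ (b + 2) / 2 ^ k := by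
    intro m k b n
    simp only [P, Bool.and_eq_true, decide_eq_true_eq, and_assoc]
    refine and_congr_right fun hn => and_congr_right fun hun => ?_
    rw [div_le_two_rpow_iff _ _ _ _ _ hun, ← two_rpow_le_div_iff _ _ _ _ _ (hu'pos n hn)]
    push_cast
    rfl
  -- The search ends because the error bound is `2` rather than `1`: with `b = ⌈y 2^k⌉ - 1` both
  -- inequalities at `T` are strict, so by continuity they persist for rational bounds close enough
  -- to `T`.
  have hex : ∀ x, ∃ y, P x y = true := by
    rintro ⟨m, k⟩
    set y : ℝ := 2 ^ (-(m : ℝ) / T) with hy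
    have hy0 : 0 < y := Real.rpow_pos_of_pos (by norm_num) _
    have hyk : 0 < y * 2 ^ k := by positivity
    obtain ⟨b, hb⟩ : ∃ b, ⌈y * 2 ^ k⌉₊ = b + 1 :=
      Nat.exists_eq_add_one.2 (Nat.ceil_pos.2 hyk)
    have hb1 : (b : ℝ) < y * 2 ^ k := by
      rw [← Nat.lt_ceil, hb]; exact Nat.lt_succ_self b
    have hb2 : y * 2 ^ k < b + 2 := by
      have := Nat.le_ceil (y * 2 ^ k)
      rw [hb] at this
      push_cast at this
      linarith
    have hcont : ContinuousAt (fun t : ℝ => (2 : ℝ) ^ (-(m : ℝ) / t)) T :=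
      ContinuousAt.rpow continuousAt_const
        (ContinuousAt.div continuousAt_const continuousAt_id h0.ne') (Or.inl two_ne_zero)
    have hlim : Tendsto (fun n : ℕ => (2 : ℝ) / n) atTop (𝓝 0) :=
      tendsto_const_div_atTop_nhds_zero_nat 2
    have hlu : Tendsto (fun n => (u n / v n : ℝ)) atTop (𝓝 T) := by
      refine tendsto_of_tendsto_of_tendsto_of_le_of_le' (g := fun n : ℕ => T - 2 / n)
        (by simpa using hlim.const_sub T) tendsto_const_nhds ?_ ?_ <;>
      · filter_upwards [eventually_ge_atTop 1] with n hn
        obtain ⟨_, h1, _, h2, _⟩ := h n hn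
        first | exact h1.le | exact h2.le
    have hlu' : Tendsto (fun n => (u' n / v n : ℝ)) atTop (𝓝 T) := by
      refine tendsto_of_tendsto_of_tendsto_of_le_of_le' (h := fun n : ℕ => T + 2 / n)
        tendsto_const_nhds (by simpa using hlim.const_add T) ?_ ?_ <;>
      · filter_upwards [eventually_ge_atTop 1] with n hn
        obtain ⟨_, _, h1, _, h2⟩ := h n hn
        first | exact h1.le | exact h2.le
    have e1 := (hcont.tendsto.comp hlu).eventually_const_lt ((div_lt_iff₀ (by positivity)).2 hb1)
    have e2 := (hcont.tendsto.comp hlu').eventually_lt_const ((lt_div_iff₀ (by positivity)).2 hb2)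
    have e3 := hlu.eventually_const_lt h0
    obtain ⟨n, h1, h2, h3, h4⟩ :=
      (e1.and (e2.and (e3.and (eventually_ge_atTop 1)))).exists
    refine ⟨(b, n), (hPiff _ _ _ _).2 ⟨h4, ?_, h1.le, h2.le⟩⟩
    by_contra h5
    simp only [not_lt, Nat.le_zero] at h5
    simp [h5] at h3
  obtain ⟨g, hg, hgP⟩ := exists_computable_search hP hex
  refine ⟨fun m k => (g (m, k)).1, Computable.fst.comp hg, fun m k => ?_⟩
  obtain ⟨hn, hun, h1, h2⟩ := (hPiff m k (g (m, k)).1 (g (m, k)).2).1 (hgP (m, k))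
  obtain ⟨hv0, h3, h4, -⟩ := h _ hn
  have hun' : (0 : ℝ) < u (g (m, k)).2 / v (g (m, k)).2 := by positivity
  exact ⟨h1.trans (two_rpow_neg_div_mono m hun' h3.le), (two_rpow_neg_div_mono m h0 h4.le).trans h2⟩

end Approximation

/-! ### Convergence, left-computability and weak randomness. -/

section Weights

open Filter Topology

variable {U V : List Bool →. List Bool} {T : ℝ} {e : ℕ → Option (List Bool)} {W : ℕ → ℕ → ℕ}

/-- The contribution `2 ^ (-|s| / T)` of an enumerated string. -/
noncomputable def weight (T : ℝ) (o : Option (List Bool)) : ℝ :=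
  o.elim 0 fun s => 2 ^ (-(s.length : ℝ) / T)

theorem weight_nonneg (T : ℝ) (o : Option (List Bool)) : 0 ≤ weight T o := by
  rcases o with - | s
  · exact le_rfl
  · exact Real.rpow_nonneg (by norm_num) _

theorem weight_some_le (h0 : 0 < T) (h1 : T ≤ 1) (s : List Bool) :
    ENNReal.ofReal ((2 : ℝ) ^ (-(s.length : ℝ) / T)) ≤ 2⁻¹ ^ s.length := by
  have h : (2⁻¹ : ℝ≥0∞) ^ s.length = ENNReal.ofReal ((2 : ℝ) ^ (-(s.length : ℝ))) := by
    rw [Real.rpow_neg (by norm_num), Real.rpow_natCast, ← inv_pow,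
      ENNReal.ofReal_pow (by norm_num), ENNReal.ofReal_inv_of_pos (by norm_num)]
    simp
  rw [h]
  refine ENNReal.ofReal_le_ofReal (Real.rpow_le_rpow_of_exponent_le (by norm_num) ?_)
  rw [neg_div, neg_le_neg_iff]
  exact le_div_self (by positivity) h0 h1

theorem CS_le (hV : IsPrefixFreeMachine V) (h0 : 0 < T) (h1 : T ≤ 1) : CS V T ≤ 2⁻¹ :=
  (ENNReal.tsum_le_tsum fun s : compressibleStrings V => weight_some_le h0 h1 (s : List Bool)).trans (tsum_compressibleStrings_le hV)

theorem CS_ne_top (hV : IsPrefixFreeMachine V) (h0 : 0 < T) (h1 : T ≤ 1) : CS V T ≠ ⊤ :=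
  ((CS_le hV h0 h1).trans_lt (by simp)).ne

/-- The bound `1/2` on the sum lets `firstBits` read off the digits of the value itself. -/
theorem fract_toReal_CS (hV : IsPrefixFreeMachine V) (h0 : 0 < T) (h1 : T ≤ 1) :
    Int.fract (CS V T).toReal = (CS V T).toReal := by
  refine Int.fract_eq_self.2 ⟨ENNReal.toReal_nonneg, ?_⟩
  have h : (CS V T).toReal ≤ (2⁻¹ : ℝ≥0∞).toReal :=
    ENNReal.toReal_mono (by simp) (CS_le hV h0 h1)
  refine h.trans_lt ?_
  simp only [ENNReal.toReal_inv, ENNReal.toReal_ofNat]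
  norm_num

theorem hasSum_weight (hfin : CS V T ≠ ⊤)
    (he : ∀ s, s ∈ compressibleStrings V ↔ ∃ k, e k = some s)
    (hinj : ∀ i j s, e i = some s → e j = some s → i = j) :
    HasSum (fun k => weight T (e k)) (CS V T).toReal := by
  have h := tsum_enumeration he hinj fun s => ENNReal.ofReal ((2 : ℝ) ^ (-(s.length : ℝ) / T))
  have h2 := ENNReal.hasSum_toReal (f := fun k =>
    (e k).elim 0 fun s => ENNReal.ofReal ((2 : ℝ) ^ (-(s.length : ℝ) / T))) (h ▸ hfin)
  have h3 : ∀ k, ((e k).elim 0 fun s =>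
      ENNReal.ofReal ((2 : ℝ) ^ (-(s.length : ℝ) / T))).toReal = weight T (e k) := by
    intro k
    rcases e k with - | s
    · simp [weight]
    · exact ENNReal.toReal_ofReal (Real.rpow_nonneg (by norm_num) _)
  rw [← ENNReal.tsum_toReal_eq, h] at h2
  · simp only [h3] at h2
    exact h2
  · intro k
    rcases e k with - | s <;> simp

/-- The approximation of `2 ^ k` times the weight of an enumerated string given by `W`. -/
def approxWeight (W : ℕ → ℕ → ℕ) (o : Option (List Bool)) (k : ℕ) : ℕ :=
  o.elim 0 fun s => W s.length k

theorem computable_approxWeight (hW : Computable₂ W) : Computable₂ (approxWeight W) := by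
  have h : Computable fun p : Option (List Bool) × ℕ =>
      (Option.casesOn p.1 0 fun s => W s.length p.2 : ℕ) :=
    Computable.option_casesOn Computable.fst (Computable.const 0)
      (hW.comp (Computable.list_length.comp Computable.snd)
        (Computable.snd.comp Computable.fst)).to₂
  exact h.of_eq fun ⟨o, k⟩ => by cases o <;> rfl

theorem approxWeight_bounds
    (hW : ∀ m k, (W m k / 2 ^ k : ℝ) ≤ 2 ^ (-(m : ℝ) / T) ∧
      (2 : ℝ) ^ (-(m : ℝ) / T) ≤ (W m k + 2) / 2 ^ k) (o : Option (List Bool)) (k : ℕ) :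
    (approxWeight W o k / 2 ^ k : ℝ) ≤ weight T o ∧
      weight T o ≤ (approxWeight W o k + 2) / 2 ^ k := by
  rcases o with - | s
  · simp only [approxWeight, weight, Option.elim_none, Nat.cast_zero, zero_div, le_refl, true_and]
    positivity
  · exact hW s.length k

/-- A recursive sequence of dyadic rationals which converges from below to the sum of the
weights. -/
theorem exists_computable_lower_approx (hT : ComputableReal T) (h0 : 0 < T) (hec : Computable e)
    {a : ℝ} (ha : HasSum (fun k => weight T (e k)) a) :
    ∃ F : ℕ → ℕ, Computable F ∧
      (∀ k, (F k / 2 ^ (2 * k) : ℝ) ≤ ∑ j ∈ Finset.range k, weight T (e j)) ∧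
      Tendsto (fun k => (F k / 2 ^ (2 * k) : ℝ)) atTop (𝓝 a) := by
  obtain ⟨W, hWc, hW⟩ := exists_computable_near_rpow hT h0
  have hlow : ∀ k, ((∑ j ∈ Finset.range k, approxWeight W (e j) (2 * k) : ℕ) / 2 ^ (2 * k) : ℝ) ≤
      ∑ j ∈ Finset.range k, weight T (e j) := fun k => by
    push_cast
    rw [Finset.sum_div]
    exact Finset.sum_le_sum fun j _ => (approxWeight_bounds hW _ _).1
  -- There are `k` terms, each with error at most `2 / 4^k`; precision `2 * k` makes the total error
  -- vanish in the limit.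
  have hupp : ∀ k, ∑ j ∈ Finset.range k, weight T (e j) - k * 2 * (1 / 4) ^ k ≤
      ((∑ j ∈ Finset.range k, approxWeight W (e j) (2 * k) : ℕ) / 2 ^ (2 * k) : ℝ) := fun k => by
    have h4 : (1 / 4 : ℝ) ^ k = 1 / 2 ^ (2 * k) := by rw [pow_mul, div_pow]; norm_num
    have h : ∑ j ∈ Finset.range k, weight T (e j) ≤
        ∑ j ∈ Finset.range k, ((approxWeight W (e j) (2 * k) : ℝ) / 2 ^ (2 * k) +
          2 / 2 ^ (2 * k)) :=
      Finset.sum_le_sum fun j _ => by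
        rw [← add_div]; exact (approxWeight_bounds hW _ _).2
    rw [Finset.sum_add_distrib, Finset.sum_const, Finset.card_range, nsmul_eq_mul,
      ← Finset.sum_div] at h
    rw [h4]
    push_cast
    have h5 : (k : ℝ) * 2 * (1 / 2 ^ (2 * k)) = k * (2 / 2 ^ (2 * k)) := by ring
    linarith
  refine ⟨fun k => ∑ j ∈ Finset.range k, approxWeight W (e j) (2 * k), ?_, hlow, ?_⟩
  · exact computable_sum_range
      ((computable_approxWeight hWc).comp (hec.comp Computable.snd)
        (computable_mul (Computable.const 2) Computable.fst)) Computable.id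
  · refine tendsto_of_tendsto_of_tendsto_of_le_of_le ?_ ha.tendsto_sum_nat hupp hlow
    have h := (tendsto_self_mul_const_pow_of_abs_lt_one (r := (1 / 4 : ℝ))
      (by rw [abs_of_pos] <;> norm_num)).const_mul 2
    have h' : Tendsto (fun k : ℕ => (k : ℝ) * 2 * (1 / 4) ^ k) atTop (𝓝 0) := by
      simpa [mul_comm, mul_left_comm, mul_assoc] using h
    simpa using ha.tendsto_sum_nat.sub h'

theorem leftComputable_of_hasSum (hT : ComputableReal T) (h0 : 0 < T) (hec : Computable e)
    {a : ℝ} (ha : HasSum (fun k => weight T (e k)) a) : LeftComputable a := by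
  obtain ⟨F, hF, hlow, hlim⟩ := exists_computable_lower_approx hT h0 hec ha
  have hcast : ∀ n, ((-(F n / 2 ^ (2 * n) : ℚ) : ℚ) : ℝ) = -(F n / 2 ^ (2 * n) : ℝ) := fun n => by
    push_cast; rfl
  refine ⟨fun n => -(F n / 2 ^ (2 * n)), ⟨fun _ => 0, F, fun n => 2 ^ (2 * n) - 1,
    Computable.const 0, hF, computable_sub (computable_pow (Computable.const 2)
      (computable_mul (Computable.const 2) Computable.id)) (Computable.const 1), fun n => ?_⟩,
    fun n _ => ?_, ?_⟩
  · rw [Nat.cast_sub Nat.one_le_two_pow]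
    push_cast
    ring
  · rw [hcast]
    exact neg_le_neg ((hlow n).trans (sum_le_hasSum _ (fun _ _ => weight_nonneg _ _) ha))
  · simp_rw [hcast]
    exact hlim.neg

theorem coe_complexity_eq {s p : List Bool} (h : complexity U s = p.length) :
    ((complexity U s : ℝ≥0∞) : EReal) = ((p.length : ℝ) : EReal) := by
  rw [h, ENat.toENNReal_coe, ← ENNReal.coe_natCast, EReal.coe_nnreal_eq_coe_real,
    NNReal.coe_natCast]

/-- From a prefix of the sum one computes an incompressible string of length `T n - O(1)`; its
`V`-complexity is at least its length and at most a constant above the `U`-complexity of the prefix.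
-/
theorem weaklyChaitinRandom_CS (hU : IsPrefixFreeMachine U) (hV : IsOptimalPrefixFreeMachine V)
    (hT : ComputableReal T) (h0 : 0 < T) (h1 : T ≤ 1) (hec : Computable e)
    (he : ∀ s, s ∈ compressibleStrings V ↔ ∃ k, e k = some s)
    (ha : HasSum (fun k => weight T (e k)) (CS V T).toReal) :
    WeaklyChaitinRandom U T (CS V T).toReal := by
  set a := (CS V T).toReal
  have hfract : Int.fract a = a := fract_toReal_CS hV.1 h0 h1
  have ha0 : 0 ≤ a := ENNReal.toReal_nonneg
  obtain ⟨F, hF, hlow, hlim⟩ := exists_computable_lower_approx hT h0 hec ha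
  obtain ⟨L, hL, hLT⟩ := exists_computable_near_mul hT h0
  -- Accepts a stage `k` whose lower bound exceeds the prefix minus `2^(-n)`, with a string of
  -- length `L n - 4` not listed before `k`. The slack `2^(-n)` guarantees such a stage even if the
  -- prefix itself is never reached.
  let P : List Bool → ℕ × List Bool → Bool := fun x y =>
    (decide (binVal x * 2 ^ (2 * y.1) < F y.1 * 2 ^ x.length + 2 ^ (2 * y.1)) &&
      decide (y.2.length = L x.length - 4)) &&
    decide (∑ j ∈ Finset.range y.1, cond (decide (e j = some y.2)) 1 0 = 0)
  have hP : Computable₂ P := by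
    have hx : Computable fun z : List Bool × ℕ × List Bool => z.1.length :=
      Computable.list_length.comp Computable.fst
    have hk : Computable fun z : List Bool × ℕ × List Bool => z.2.1 :=
      Computable.fst.comp Computable.snd
    have hs : Computable fun z : List Bool × ℕ × List Bool => z.2.2 :=
      Computable.snd.comp Computable.snd
    have h2 : Computable fun _ : List Bool × ℕ × List Bool => 2 := Computable.const 2
    have h4 := computable_pow h2 (computable_mul h2 hk)
    exact computable_and
      (computable_and
        (computable_decide_lt
          (computable_mul (computable_binVal.comp Computable.fst) h4)
          (computable_add (computable_mul (hF.comp hk) (computable_pow h2 hx)) h4))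
        (computable_decide_eq (Computable.list_length.comp hs)
          (computable_sub (hL.comp hx) (Computable.const 4))))
      (computable_decide_eq
        (computable_sum_range
          (Computable.cond
            (computable_decide_eq (hec.comp Computable.snd)
              (Computable.option_some.comp (hs.comp Computable.fst)))
            (Computable.const 1) (Computable.const 0)) hk)
        (Computable.const 0))
  have hPiff : ∀ n k s, P (firstBits a n) (k, s) = true ↔
      ((⌊a * 2 ^ n⌋₊ : ℝ) < (F k / 2 ^ (2 * k) : ℝ) * 2 ^ n + 1 ∧ s.length = L n - 4) ∧
        ∀ j < k, e j ≠ some s := by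
    intro n k s
    simp only [P, Bool.and_eq_true, decide_eq_true_eq, binVal_firstBits, length_firstBits, hfract]
    refine and_congr (and_congr ?_ Iff.rfl) ?_
    · rw [div_mul_eq_mul_div, div_add_one (by positivity), lt_div_iff₀ (by positivity)]
      norm_cast
    · simp [cond_eq_ite]
  have hsound : ∀ n k s, P (firstBits a n) (k, s) = true → s ∉ compressibleStrings V := by
    intro n k s h hs
    obtain ⟨⟨h2, h3⟩, h4⟩ := (hPiff n k s).1 h
    obtain ⟨j, hj⟩ := (he s).1 hs
    have hjk : k ≤ j := by
      by_contra hlt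
      exact h4 j (not_le.1 hlt) hj
    have hslen : 0 < s.length := by
      have : (0 : ℕ∞) < s.length := lt_of_le_of_lt zero_le hs
      exact_mod_cast this
    have h5 : ∑ i ∈ Finset.range k, weight T (e i) + weight T (e j) ≤ a := by
      have hnot : j ∉ Finset.range k := by simpa using hjk
      rw [add_comm, ← Finset.sum_insert (f := fun i => weight T (e i)) hnot]
      exact sum_le_hasSum _ (fun _ _ => weight_nonneg _ _) ha
    have h6 := Nat.lt_floor_add_one (a * 2 ^ n)
    have hn : (0 : ℝ) < 2 ^ n := by positivity
    -- One unit comes from truncating the sum to `n` bits, the other from the slack in the search.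
    -- This forces `|s| > T n - T`, whereas `|s| = L n - 4 ≤ T n - 2`. The subtraction of `4` is not
    -- truncated, as a compressible string is nonempty.
    have h7 : weight T (e j) * 2 ^ n < 2 := by
      have h8 : weight T (e j) * 2 ^ n ≤ a * 2 ^ n - (F k / 2 ^ (2 * k) : ℝ) * 2 ^ n := by
        rw [← sub_mul]
        exact mul_le_mul_of_nonneg_right (by linarith [hlow k]) hn.le
      linarith
    have h8 : (2 : ℝ) ^ (-(s.length : ℝ) / T + n) < 2 ^ (1 : ℝ) := by
      rw [Real.rpow_add (by norm_num), Real.rpow_natCast, Real.rpow_one]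
      simpa [hj, weight] using h7
    have h9 := (Real.rpow_lt_rpow_left_iff (by norm_num)).1 h8
    have h10 : T * n < T + s.length := by
      have : T * (-(s.length : ℝ) / T + n) < T * 1 := by gcongr
      rw [mul_add, mul_div_cancel₀ _ h0.ne'] at this
      linarith
    have h11 := (hLT n).2
    have h12 : ((s.length + 4 : ℕ) : ℝ) = L n := by
      congr 1
      omega
    push_cast at h12
    linarith
  have hex : ∀ n, ∃ y, P (firstBits a n) y = true := by
    intro n
    have hn : (0 : ℝ) < 2 ^ n := by positivity
    obtain ⟨k, hk⟩ := (hlim.eventually_const_lt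
      (show a - 1 / 2 ^ n < a by linarith [one_div_pos.2 hn])).exists
    obtain ⟨s, hs, hsc⟩ := exists_incompressible hV.1 (L n - 4)
    refine ⟨(k, s), (hPiff n k s).2 ⟨⟨?_, hs⟩, fun j _ hj => hsc ((he s).2 ⟨j, hj⟩)⟩⟩
    have h2 := Nat.floor_le (mul_nonneg ha0 hn.le)
    have h3 := mul_lt_mul_of_pos_right hk hn
    rw [sub_mul, one_div_mul_cancel hn.ne'] at h3
    linarith
  obtain ⟨Ψ, hΨ, hΨ1, hΨ2⟩ := exists_partrec_search hP
  obtain ⟨d, hd⟩ := exists_program_length_le_of_partrec hU hV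
    (hΨ.map (Computable.snd.comp Computable.snd).to₂)
  refine ⟨d + 5, fun n _ => ?_⟩
  by_cases htop : complexity U (firstBits a n) = ⊤
  · rw [htop]
    simp
  obtain ⟨p, hp, hpl⟩ := exists_program_of_complexity_ne_top htop
  obtain ⟨y, hy⟩ := hex n
  obtain ⟨⟨k, s⟩, hz⟩ := hΨ2 _ _ hy
  have hzP := hΨ1 _ _ hz
  obtain ⟨r, hr, hrl⟩ := hd p _ s hp (Part.mem_map (fun y : ℕ × List Bool => y.2) hz)
  have hslen : s.length ≤ r.length := by
    have h2 := (not_lt.1 (hsound n k s hzP)).trans (complexity_le hr)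
    exact_mod_cast h2
  have h3 := ((hPiff n k s).1 hzP).1.2
  have h4 : (L n : ℝ) ≤ p.length + d + 4 := by
    have : L n ≤ p.length + d + 4 := by omega
    exact_mod_cast this
  rw [coe_complexity_eq hpl, EReal.coe_le_coe_iff]
  push_cast
  linarith [(hLT n).1]

end Weights

/-! ### Counting changes of integer parts, and the sum over levels. -/

section Counting

/-- The number of times that the integer part of the partial sums of a nonnegative sequence
changes. -/
theorem sum_floor_change_le {A : ℕ → ℝ} (hA : ∀ k, 0 ≤ A k) (K : ℕ) :
    (∑ k ∈ Finset.range K, if ⌊∑ j ∈ Finset.range (k + 1), A j⌋₊ ≠ ⌊∑ j ∈ Finset.range k, A j⌋₊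
      then (1 : ℝ) else 0) ≤ 2 * ∑ k ∈ Finset.range K, min 1 (A k) := by
  set y : ℕ → ℝ := fun k => ∑ j ∈ Finset.range k, A j with hy
  have hy0 : ∀ k, 0 ≤ y k := fun k => Finset.sum_nonneg fun j _ => hA j
  have hstep : ∀ k, y (k + 1) = y k + A k := fun k => Finset.sum_range_succ _ _
  -- The fractional part serves as a potential: a step `A < 1` raises changes plus potential by at
  -- most `A`, since crossing an integer lowers the potential by one; a step `A ≥ 1` raises it by at
  -- most `2`.
  have key : (∑ k ∈ Finset.range K, if ⌊y (k + 1)⌋₊ ≠ ⌊y k⌋₊ then (1 : ℝ) else 0) +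
      (y K - ⌊y K⌋₊) ≤ 2 * ∑ k ∈ Finset.range K, min 1 (A k) := by
    induction K with
    | zero => simp [hy]
    | succ K ih =>
      rw [Finset.sum_range_succ, Finset.sum_range_succ]
      have h1 := Nat.floor_le (hy0 K)
      have h2 := Nat.lt_floor_add_one (y (K + 1))
      have h3 := hstep K
      have h4 := hA K
      by_cases hc : ⌊y (K + 1)⌋₊ = ⌊y K⌋₊
      · rw [if_neg (not_not.2 hc), hc]
        rw [hc] at h2
        have h5 : min 1 (A K) = A K := min_eq_right (by linarith)
        rw [h5]
        linarith
      · have h5 : ⌊y K⌋₊ + 1 ≤ ⌊y (K + 1)⌋₊ :=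
          Nat.succ_le_of_lt (lt_of_le_of_ne (Nat.floor_mono (by linarith)) (Ne.symm hc))
        have h6 : (⌊y K⌋₊ : ℝ) + 1 ≤ ⌊y (K + 1)⌋₊ := by exact_mod_cast h5
        rw [if_pos hc]
        rcases le_total 1 (A K) with h7 | h7
        · rw [min_eq_left h7]
          linarith
        · rw [min_eq_right h7]
          linarith
  have := Nat.floor_le (hy0 K)
  linarith

theorem tsum_floor_change_le {A : ℕ → ℝ} (hA : ∀ k, 0 ≤ A k) :
    (∑' k : ℕ, if ⌊∑ j ∈ Finset.range (k + 1), A j⌋₊ ≠ ⌊∑ j ∈ Finset.range k, A j⌋₊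
      then (1 : ℝ≥0∞) else 0) ≤ 2 * ∑' k, ENNReal.ofReal (min 1 (A k)) := by
  refine ENNReal.tsum_le_of_sum_range_le fun K => ?_
  have h0 : ∀ k, 0 ≤ min 1 (A k) := fun k => le_min zero_le_one (hA k)
  calc _ = ENNReal.ofReal (∑ k ∈ Finset.range K,
        if ⌊∑ j ∈ Finset.range (k + 1), A j⌋₊ ≠ ⌊∑ j ∈ Finset.range k, A j⌋₊
          then (1 : ℝ) else 0) := by
        rw [ENNReal.ofReal_sum_of_nonneg fun k _ => by split_ifs <;> simp]
        exact Finset.sum_congr rfl fun k _ => by split_ifs <;> simp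
    _ ≤ ENNReal.ofReal (2 * ∑ k ∈ Finset.range K, min 1 (A k)) :=
        ENNReal.ofReal_le_ofReal (sum_floor_change_le hA K)
    _ = 2 * ∑ k ∈ Finset.range K, ENNReal.ofReal (min 1 (A k)) := by
        rw [ENNReal.ofReal_mul (by norm_num), ENNReal.ofReal_sum_of_nonneg fun k _ => h0 k]
        simp
    _ ≤ _ := by gcongr; exact ENNReal.sum_le_tsum _

theorem tsum_pow_natAbs_sub_le (r : ℝ≥0∞) (N : ℕ) :
    ∑' n : ℕ, r ^ ((n : ℤ) - N).natAbs ≤ 2 * ∑' j : ℕ, r ^ j := by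
  have hinj : Function.Injective fun n : ℕ => (decide (n < N), ((n : ℤ) - N).natAbs) := by
    intro m n h
    simp only [Prod.mk.injEq, decide_eq_decide] at h
    omega
  calc _ ≤ ∑' p : Bool × ℕ, r ^ p.2 :=
        ENNReal.tsum_comp_le_tsum_of_injective hinj fun p : Bool × ℕ => r ^ p.2
    _ = ∑' _ : Bool, ∑' j : ℕ, r ^ j := ENNReal.tsum_prod (f := fun _ j => r ^ j)
    _ = _ := by rw [tsum_fintype, Fintype.sum_bool, two_mul]

theorem tsum_pow_ne_top {r : ℝ≥0∞} (hr : r < 1) : ∑' j : ℕ, r ^ j ≠ ⊤ := by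
  rw [ENNReal.tsum_geometric]
  exact ENNReal.inv_ne_top.2 (tsub_pos_of_lt hr).ne'

/-- For `0 < T < 1`, the sum over all `n` of `2 ^ (-T n) min {1, 2 ^ n w}` is at most a constant
times `w ^ T`, for `w` of the form `2 ^ (-m / T)`. -/
theorem exists_tsum_min_le {T : ℝ} (h0 : 0 < T) (h1 : T < 1) :
    ∃ C : ℝ≥0∞, C ≠ ⊤ ∧ ∀ m : ℕ,
      ∑' n : ℕ, ENNReal.ofReal ((2 : ℝ) ^ (-T * n) * min 1 (2 ^ n * 2 ^ (-(m : ℝ) / T))) ≤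
        C * 2⁻¹ ^ m := by
  -- With `x = m / T`, the term is `2^(-m)` times `2^(-T(n-x))` for `n ≥ x` and times
  -- `2^(-(1-T)(x-n))` for `n < x`. Both sides decay at least at rate `c`, positive because `T < 1`;
  -- the factor `2^c` pays for replacing `x` by its integer part.
  set c := min T (1 - T) with hc
  have hc0 : 0 < c := lt_min h0 (by linarith)
  set ρ : ℝ := 2 ^ (-c) with hρ
  have hρ0 : 0 < ρ := Real.rpow_pos_of_pos (by norm_num) _
  have hρ1 : ρ < 1 := Real.rpow_lt_one_of_one_lt_of_neg (by norm_num) (by linarith)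
  set r : ℝ≥0∞ := ENNReal.ofReal ρ with hr
  have hr1 : r < 1 := by rw [hr]; exact ENNReal.ofReal_lt_one.2 hρ1
  refine ⟨ENNReal.ofReal (2 ^ c) * (2 * ∑' j : ℕ, r ^ j),
    ENNReal.mul_ne_top ENNReal.ofReal_ne_top
      (ENNReal.mul_ne_top (by simp) (tsum_pow_ne_top hr1)), fun m => ?_⟩
  set x : ℝ := m / T with hx
  have hx0 : 0 ≤ x := by positivity
  have hTx : T * x = m := by rw [hx]; field_simp
  have hterm : ∀ n : ℕ, (2 : ℝ) ^ (-T * n) * min 1 (2 ^ n * 2 ^ (-(m : ℝ) / T)) ≤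
      2 ^ c * ρ ^ ((n : ℤ) - ⌊x⌋₊).natAbs * (1 / 2) ^ m := by
    intro n
    have hρpow : ∀ j : ℕ, ρ ^ j = 2 ^ (-c * j) := fun j => by
      rw [hρ, Real.rpow_mul (by norm_num), Real.rpow_natCast]
    have h2m : ((1 / 2 : ℝ)) ^ m = 2 ^ (-(m : ℝ)) := by
      rw [Real.rpow_neg (by norm_num), Real.rpow_natCast, one_div, inv_pow]
    have hfl := Nat.floor_le hx0
    have hfl2 := Nat.lt_floor_add_one x
    have hcT : c ≤ T := min_le_left _ _
    have hcT' : c ≤ 1 - T := min_le_right _ _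
    have h2n : (2 : ℝ) ^ n * 2 ^ (-(m : ℝ) / T) = 2 ^ ((n : ℝ) - x) := by
      rw [← Real.rpow_natCast, ← Real.rpow_add (by norm_num), neg_div, ← sub_eq_add_neg]
    rw [hρpow, h2m, ← Real.rpow_add (by norm_num), ← Real.rpow_add (by norm_num), h2n]
    rcases le_or_gt x n with hxn | hxn
    · have habs : ((((n : ℤ) - ⌊x⌋₊).natAbs : ℕ) : ℝ) = n - ⌊x⌋₊ := by
        have h3 : ⌊x⌋₊ ≤ n := Nat.floor_le_of_le hxn
        have h4 : ((n : ℤ) - ⌊x⌋₊).natAbs = n - ⌊x⌋₊ := by omega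
        rw [h4, Nat.cast_sub h3]
      rw [habs]
      refine (mul_le_of_le_one_right (by positivity) (min_le_left _ _)).trans
        (Real.rpow_le_rpow_of_exponent_le (by norm_num) ?_)
      nlinarith
    · have habs : ((((n : ℤ) - ⌊x⌋₊).natAbs : ℕ) : ℝ) = ⌊x⌋₊ - n := by
        have h3 : n ≤ ⌊x⌋₊ := Nat.le_floor hxn.le
        have h4 : ((n : ℤ) - ⌊x⌋₊).natAbs = ⌊x⌋₊ - n := by omega
        rw [h4, Nat.cast_sub h3]
      rw [habs]
      refine (mul_le_mul_of_nonneg_left (min_le_right _ _) (by positivity)).trans ?_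
      rw [← Real.rpow_add (by norm_num)]
      refine Real.rpow_le_rpow_of_exponent_le (by norm_num) ?_
      nlinarith
  calc _ ≤ ∑' n : ℕ, ENNReal.ofReal (2 ^ c) * r ^ ((n : ℤ) - ⌊x⌋₊).natAbs * 2⁻¹ ^ m := by
        refine ENNReal.tsum_le_tsum fun n => (ENNReal.ofReal_le_ofReal (hterm n)).trans_eq ?_
        rw [ENNReal.ofReal_mul (by positivity), ENNReal.ofReal_mul (by positivity),
          ENNReal.ofReal_pow hρ0.le, ENNReal.ofReal_pow (by norm_num), one_div,
          ENNReal.ofReal_inv_of_pos (by norm_num)]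
        simp [hr]
    _ = ENNReal.ofReal (2 ^ c) * (∑' n : ℕ, r ^ ((n : ℤ) - ⌊x⌋₊).natAbs) * 2⁻¹ ^ m := by
        rw [ENNReal.tsum_mul_right, ENNReal.tsum_mul_left]
    _ ≤ _ := by gcongr; exact tsum_pow_natAbs_sub_le r _

end Counting

/-! ### Strict compressibility for `T < 1`. -/

section Compressibility

open Filter Topology

variable {U V : List Bool →. List Bool} {T : ℝ} {e : ℕ → Option (List Bool)} {W : ℕ → ℕ → ℕ}

/-- The Kraft–Chaitin theorem for a family of requests over an arbitrary index type. -/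
theorem exists_program_of_family {β : Type*} [Primcodable β]
    (hU : IsOptimalPrefixFreeMachine U) {q : β → Option (ℕ × List Bool)} (hq : Computable q)
    (hs : ∑' y, requestWeight (q y) ≠ ⊤) :
    ∃ d : ℕ, ∀ y l s, q y = some (l, s) → ∃ p, s ∈ U p ∧ p.length ≤ l + d := by
  -- Unlike `decode`, `decode₂` answers only on genuine codes, so every request is counted exactly
  -- once.
  have hdec : ∀ y : β, Encodable.decode₂ β (Encodable.encode y) = some y :=
    fun y => Encodable.decode₂_encode y
  have hsum : ∑' i, requestWeight ((Encodable.decode₂ β i).bind q) =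
      ∑' y, requestWeight (q y) := by
    rw [← (Encodable.encode_injective (α := β)).tsum_eq]
    · simp [hdec]
    · intro i hi
      rcases h : Encodable.decode₂ β i with - | y
      · simp [h, requestWeight] at hi
      · exact ⟨y, Encodable.mem_decode₂.1 h⟩
  obtain ⟨d, hd⟩ := exists_program_of_request hU (q := fun i => (Encodable.decode₂ β i).bind q)
    (Computable.option_bind Primrec.decode₂.to_comp (hq.comp Computable.snd).to₂) (hsum ▸ hs)
  exact ⟨d, fun y l s h => hd (Encodable.encode y) l s (by simp [hdec, h])⟩

/-- The integer part of `2 ^ n` times the sum of the first `k` weights, up to a bounded error. -/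
def scaledSum (W : ℕ → ℕ → ℕ) (e : ℕ → Option (List Bool)) (n k : ℕ) : ℕ :=
  (∑ j ∈ Finset.range k, approxWeight W (e j) (n + j + 2) * 2 ^ (k - j)) / 2 ^ (k + 2)

/-- The approximation to `2 ^ n` times the `j`-th weight which is used in `scaledSum`. -/
noncomputable def scaledWeight (W : ℕ → ℕ → ℕ) (e : ℕ → Option (List Bool)) (n j : ℕ) : ℝ :=
  approxWeight W (e j) (n + j + 2) / 2 ^ (j + 2)

theorem computable_scaledSum (hW : Computable₂ W) (he : Computable e) :
    Computable₂ (scaledSum W e) := by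
  have hn : Computable fun z : (ℕ × ℕ) × ℕ => z.1.1 := Computable.fst.comp Computable.fst
  have hk : Computable fun z : (ℕ × ℕ) × ℕ => z.1.2 := Computable.snd.comp Computable.fst
  have hj : Computable fun z : (ℕ × ℕ) × ℕ => z.2 := Computable.snd
  refine computable_div (computable_sum_range (g := fun z : ℕ × ℕ => fun j =>
    approxWeight W (e j) (z.1 + j + 2) * 2 ^ (z.2 - j)) ?_ Computable.snd)
    (computable_pow (Computable.const 2) (computable_add Computable.snd (Computable.const 2)))
  exact computable_mul
    ((computable_approxWeight hW).comp (he.comp hj)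
      (computable_add (computable_add hn hj) (Computable.const 2)))
    (computable_pow (Computable.const 2) (computable_sub hk hj))

theorem scaledSum_eq_floor (n k : ℕ) :
    scaledSum W e n k = ⌊∑ j ∈ Finset.range k, scaledWeight W e n j⌋₊ := by
  have h : ∑ j ∈ Finset.range k, scaledWeight W e n j =
      ((∑ j ∈ Finset.range k, approxWeight W (e j) (n + j + 2) * 2 ^ (k - j) : ℕ) : ℝ) /
        (2 ^ (k + 2) : ℕ) := by
    push_cast
    rw [Finset.sum_div]
    refine Finset.sum_congr rfl fun j hj => ?_
    have hjk : j < k := Finset.mem_range.1 hj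
    have h2 : k + 2 = (j + 2) + (k - j) := by omega
    rw [scaledWeight, h2, pow_add 2 (j + 2) (k - j)]
    field_simp
  rw [h, Nat.floor_div_natCast, Nat.floor_natCast, scaledSum]

theorem scaledWeight_nonneg (n j : ℕ) : 0 ≤ scaledWeight W e n j := by
  rw [scaledWeight]; positivity

/-- The precision of the `j`-th term grows with `j`, so the errors sum to at most `1`. It does not
depend on the number of terms summed, so the partial sums are nondecreasing and their integer parts
can be counted. -/
theorem scaledWeight_bounds
    (hW : ∀ m k, (W m k / 2 ^ k : ℝ) ≤ 2 ^ (-(m : ℝ) / T) ∧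
      (2 : ℝ) ^ (-(m : ℝ) / T) ≤ (W m k + 2) / 2 ^ k) (n j : ℕ) :
    scaledWeight W e n j ≤ 2 ^ n * weight T (e j) ∧
      2 ^ n * weight T (e j) ≤ scaledWeight W e n j + 1 / 2 * (1 / 2) ^ j := by
  obtain ⟨h1, h2⟩ := approxWeight_bounds hW (e j) (n + j + 2)
  have hn : (0 : ℝ) < 2 ^ n := by positivity
  have h3 : (2 : ℝ) ^ (n + j + 2) = 2 ^ n * 2 ^ (j + 2) := by rw [add_assoc, pow_add]
  have h4 : ∀ x : ℝ, 2 ^ n * (x / 2 ^ (n + j + 2)) = x / 2 ^ (j + 2) := fun x => by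
    rw [h3]; field_simp
  have h5 : (1 / 2 : ℝ) * (1 / 2) ^ j = 2 / 2 ^ (j + 2) := by
    rw [pow_add, div_pow, one_pow]; field_simp
  constructor
  · rw [scaledWeight, ← h4]
    exact mul_le_mul_of_nonneg_left h1 hn.le
  · rw [scaledWeight, h5, ← add_div, ← h4]
    exact mul_le_mul_of_nonneg_left h2 hn.le

theorem sum_scaledWeight_bounds
    (hW : ∀ m k, (W m k / 2 ^ k : ℝ) ≤ 2 ^ (-(m : ℝ) / T) ∧
      (2 : ℝ) ^ (-(m : ℝ) / T) ≤ (W m k + 2) / 2 ^ k) (n k : ℕ) :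
    ∑ j ∈ Finset.range k, scaledWeight W e n j ≤
        2 ^ n * ∑ j ∈ Finset.range k, weight T (e j) ∧
      2 ^ n * ∑ j ∈ Finset.range k, weight T (e j) ≤
        ∑ j ∈ Finset.range k, scaledWeight W e n j + 1 := by
  rw [Finset.mul_sum]
  refine ⟨Finset.sum_le_sum fun j _ => (scaledWeight_bounds hW n j).1, ?_⟩
  refine (Finset.sum_le_sum fun j _ => (scaledWeight_bounds hW n j).2).trans ?_
  rw [Finset.sum_add_distrib, ← Finset.mul_sum]
  have h : ∑ j ∈ Finset.range k, (1 / 2 : ℝ) ^ j ≤ 2 := sum_geometric_two_le k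
  linarith

/-- The scaled sums attain, at a stage where they change, a value which determines the first `n`
bits of the limit up to three possibilities. -/
theorem exists_scaledSum_near {a : ℝ}
    (hW : ∀ m k, (W m k / 2 ^ k : ℝ) ≤ 2 ^ (-(m : ℝ) / T) ∧
      (2 : ℝ) ^ (-(m : ℝ) / T) ≤ (W m k + 2) / 2 ^ k)
    (ha : HasSum (fun k => weight T (e k)) a) (n : ℕ) :
    ∃ k, (k = 0 ∨ scaledSum W e n k ≠ scaledSum W e n (k - 1)) ∧
      scaledSum W e n k ≤ ⌊a * 2 ^ n⌋₊ ∧ ⌊a * 2 ^ n⌋₊ ≤ scaledSum W e n k + 2 := by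
  have hn : (0 : ℝ) < 2 ^ n := by positivity
  have ha0 : 0 ≤ a := ha.nonneg fun _ => weight_nonneg _ _
  have hle : ∀ k, scaledSum W e n k ≤ ⌊a * 2 ^ n⌋₊ := fun k => by
    rw [scaledSum_eq_floor]
    refine Nat.floor_mono ((sum_scaledWeight_bounds hW n k).1.trans ?_)
    rw [mul_comm]
    exact mul_le_mul_of_nonneg_right (sum_le_hasSum _ (fun _ _ => weight_nonneg _ _) ha) hn.le
  have hbdd : BddAbove (Set.range (scaledSum W e n)) := ⟨_, by rintro _ ⟨k, rfl⟩; exact hle k⟩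
  obtain ⟨k₀, hk₀⟩ := Nat.sSup_mem (Set.range_nonempty (scaledSum W e n)) hbdd
  have hmax : ∀ k, scaledSum W e n k ≤ scaledSum W e n k₀ := fun k =>
    hk₀ ▸ le_csSup hbdd ⟨k, rfl⟩
  have hlim : a * 2 ^ n ≤ scaledSum W e n k₀ + 2 := by
    refine le_of_tendsto (ha.tendsto_sum_nat.mul_const (2 ^ n)) (Eventually.of_forall fun k => ?_)
    rw [mul_comm]
    refine (sum_scaledWeight_bounds hW n k).2.trans ?_
    have h1 := Nat.lt_floor_add_one (∑ j ∈ Finset.range k, scaledWeight W e n j)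
    rw [← scaledSum_eq_floor] at h1
    have h2 : (scaledSum W e n k : ℝ) ≤ scaledSum W e n k₀ := by exact_mod_cast hmax k
    linarith
  classical
  have hex : ∃ k, scaledSum W e n k = scaledSum W e n k₀ := ⟨k₀, rfl⟩
  -- The first stage at which the maximal integer part is attained is `0` or a stage of change.
  -- Rounding down and the approximation error lose at most one unit each, hence the `2`.
  refine ⟨Nat.find hex, ?_, hle _, ?_⟩
  · by_cases h : Nat.find hex = 0
    · exact Or.inl h
    · refine Or.inr fun h2 => Nat.find_min hex (Nat.sub_one_lt h) ?_
      rw [← h2, Nat.find_spec hex]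
  · rw [Nat.find_spec hex]
    refine Nat.floor_le_of_le ?_
    exact_mod_cast hlim

theorem tsum_scaledSum_change_le
    (hW : ∀ m k, (W m k / 2 ^ k : ℝ) ≤ 2 ^ (-(m : ℝ) / T) ∧
      (2 : ℝ) ^ (-(m : ℝ) / T) ≤ (W m k + 2) / 2 ^ k) (n : ℕ) :
    (∑' k : ℕ, if k = 0 ∨ scaledSum W e n k ≠ scaledSum W e n (k - 1) then (1 : ℝ≥0∞) else 0) ≤
      1 + 2 * ∑' k, ENNReal.ofReal (min 1 (2 ^ n * weight T (e k))) := by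
  rw [tsum_eq_zero_add' ENNReal.summable]
  simp only [true_or, if_true, Nat.add_eq_zero_iff, one_ne_zero, and_false, false_or,
    Nat.add_sub_cancel]
  gcongr
  simp_rw [scaledSum_eq_floor]
  refine (tsum_floor_change_le fun k => scaledWeight_nonneg n k).trans ?_
  gcongr with k
  exact (scaledWeight_bounds hW n k).1

/-- Each change of the scaled sum at level `n` triggers requests of length `L n` for the three
candidate prefixes. The true prefix is among them, and the total measure is finite because changes
at all levels are charged to the weights that cause them. -/
theorem strictlyCompressible_of_hasSum (hU : IsOptimalPrefixFreeMachine U) (hT : ComputableReal T)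
    (h0 : 0 < T) (h1 : T < 1) (hec : Computable e) {a : ℝ}
    (ha : HasSum (fun k => weight T (e k)) a) (hfract : Int.fract a = a)
    (hfin : ∑' k, (e k).elim 0 (fun s => (2⁻¹ : ℝ≥0∞) ^ s.length) ≠ ⊤) :
    StrictlyCompressible U T a := by
  obtain ⟨W, hWc, hW⟩ := exists_computable_near_rpow hT h0
  obtain ⟨L, hL, hLT⟩ := exists_computable_near_mul hT h0
  obtain ⟨C, hC, hCm⟩ := exists_tsum_min_le h0 h1
  set Y := scaledSum W e
  let R : ℕ × List Bool → Bool := fun y =>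
    -- Stage `0` is accepted separately, since `0 - 1 = 0` would otherwise show no change there.
    (decide (y.1 = 0) || !decide (Y y.2.length y.1 = Y y.2.length (y.1 - 1))) &&
      (decide (Y y.2.length y.1 ≤ binVal y.2) && decide (binVal y.2 ≤ Y y.2.length y.1 + 2))
  have hlen : Computable fun y : ℕ × List Bool => y.2.length :=
    Computable.list_length.comp Computable.snd
  have hR : Computable R := by
    have hYc := computable_scaledSum hWc hec
    have hv : Computable fun y : ℕ × List Bool => binVal y.2 :=
      computable_binVal.comp Computable.snd
    have hYk : Computable fun y : ℕ × List Bool => Y y.2.length y.1 :=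
      hYc.comp hlen Computable.fst
    exact computable_and
      (computable_or (computable_decide_eq Computable.fst (Computable.const 0))
        (computable_not (computable_decide_eq hYk
          (hYc.comp hlen (computable_sub Computable.fst (Computable.const 1))))))
      (computable_and (computable_decide_le hYk hv)
        (computable_decide_le hv (computable_add hYk (Computable.const 2))))
  have hRiff : ∀ k s, R (k, s) = true ↔ (k = 0 ∨ Y s.length k ≠ Y s.length (k - 1)) ∧
      Y s.length k ≤ binVal s ∧ binVal s ≤ Y s.length k + 2 := by
    intro k s
    simp [R]
  let q : ℕ × List Bool → Option (ℕ × List Bool) := fun y =>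
    cond (R y) (some (L y.2.length, y.2)) none
  have hq : Computable q :=
    Computable.cond hR
      (Computable.option_some.comp (Computable.pair (hL.comp hlen) Computable.snd))
      (Computable.const none)
  have hgeo : ∑' n : ℕ, ENNReal.ofReal ((2 : ℝ) ^ (-T * n)) ≠ ⊤ := by
    have h2 : ∀ n : ℕ, ENNReal.ofReal ((2 : ℝ) ^ (-T * n)) =
        ENNReal.ofReal ((2 : ℝ) ^ (-T)) ^ n := fun n => by
      rw [Real.rpow_mul (by norm_num), Real.rpow_natCast,
        ENNReal.ofReal_pow (Real.rpow_nonneg (by norm_num) _)]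
    simp_rw [h2]
    exact tsum_pow_ne_top (ENNReal.ofReal_lt_one.2
      (Real.rpow_lt_one_of_one_lt_of_neg (by norm_num) (by linarith)))
  have hLpow : ∀ n, (2⁻¹ : ℝ≥0∞) ^ L n ≤ 2 * ENNReal.ofReal ((2 : ℝ) ^ (-T * n)) := by
    intro n
    have h2 : (2⁻¹ : ℝ≥0∞) ^ L n = ENNReal.ofReal ((2 : ℝ) ^ (-(L n : ℝ))) := by
      rw [Real.rpow_neg (by norm_num), Real.rpow_natCast, ← inv_pow,
        ENNReal.ofReal_pow (by norm_num), ENNReal.ofReal_inv_of_pos (by norm_num)]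
      simp
    have h3 : (2 : ℝ≥0∞) * ENNReal.ofReal ((2 : ℝ) ^ (-T * n)) =
        ENNReal.ofReal ((2 : ℝ) ^ (1 + -T * n)) := by
      rw [Real.rpow_add (by norm_num), Real.rpow_one, ENNReal.ofReal_mul (by norm_num)]
      simp
    rw [h2, h3]
    refine ENNReal.ofReal_le_ofReal (Real.rpow_le_rpow_of_exponent_le (by norm_num) ?_)
    linarith [(hLT n).1]
  have hmin : ∀ k, ∑' n : ℕ,
      ENNReal.ofReal ((2 : ℝ) ^ (-T * n) * min 1 (2 ^ n * weight T (e k))) ≤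
        C * (e k).elim 0 fun s => 2⁻¹ ^ s.length := by
    intro k
    rcases e k with - | s
    · simp [weight]
    · exact hCm s.length
  let chg : ℕ → ℕ → ℝ≥0∞ := fun n k => if k = 0 ∨ Y n k ≠ Y n (k - 1) then 1 else 0
  let ind : ℕ → ℕ → ℕ → ℝ≥0∞ := fun n k v => if v ∈ Finset.Icc (Y n k) (Y n k + 2) then 1 else 0
  have hind : ∀ n k, ∑' v, ind n k v = 3 := fun n k => by
    rw [tsum_eq_sum (s := Finset.Icc (Y n k) (Y n k + 2)) fun v hv => if_neg hv]
    change ∑ v ∈ Finset.Icc (Y n k) (Y n k + 2),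
      (if v ∈ Finset.Icc (Y n k) (Y n k + 2) then (1 : ℝ≥0∞) else 0) = 3
    rw [Finset.sum_ite_mem, Finset.inter_self, Finset.sum_const, Nat.card_Icc,
      show Y n k + 2 + 1 - Y n k = 3 by omega]
    norm_num
  let G : ℕ × ℕ × ℕ → ℝ≥0∞ := fun x => 2⁻¹ ^ L x.1 * (chg x.1 x.2.1 * ind x.1 x.2.1 x.2.2)
  have hqG : ∀ y, requestWeight (q y) ≤ G (y.2.length, y.1, binVal y.2) := by
    rintro ⟨k, s⟩
    rcases hb : R (k, s) with - | -
    · simp [q, hb, requestWeight]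
    · obtain ⟨h2, h3, h4⟩ := (hRiff k s).1 hb
      simp only [q, hb, G, chg, ind, cond_true, if_pos h2, if_pos (Finset.mem_Icc.2 ⟨h3, h4⟩),
        requestWeight, Option.elim_some, mul_one]
      exact le_rfl
  have hinj : Function.Injective fun y : ℕ × List Bool => (y.2.length, y.1, binVal y.2) := by
    rintro ⟨k, s⟩ ⟨k', s'⟩ h
    simp only [Prod.mk.injEq] at h
    rw [h.2.1, binVal_injective h.1 h.2.2]
  -- The decisive move is exchanging the sums over levels `n` and over enumerated strings `k`: for
  -- each string the levels add up to at most `C * 2^(-|s|)`. The factor `6` is three candidates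
  -- times the `2` lost in `hLpow`.
  have hsum : ∑' y, requestWeight (q y) ≠ ⊤ := by
    have hle := calc
      ∑' y, requestWeight (q y) ≤ ∑' y : ℕ × List Bool, G (y.2.length, y.1, binVal y.2) := ENNReal.tsum_le_tsum hqG
      _ ≤ ∑' x, G x := ENNReal.tsum_comp_le_tsum_of_injective hinj G
      _ = ∑' n, ∑' k, ∑' v, 2⁻¹ ^ L n * (chg n k * ind n k v) := by
          rw [ENNReal.tsum_prod']
          exact tsum_congr fun n => ENNReal.tsum_prod'
      _ = ∑' n, 2⁻¹ ^ L n * ((∑' k, chg n k) * 3) := by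
          refine tsum_congr fun n => ?_
          simp_rw [ENNReal.tsum_mul_left, hind]
          rw [ENNReal.tsum_mul_right]
      _ ≤ ∑' n : ℕ, 2 * ENNReal.ofReal ((2 : ℝ) ^ (-T * n)) *
            ((1 + 2 * ∑' k, ENNReal.ofReal (min 1 (2 ^ n * weight T (e k)))) * 3) := by
          refine ENNReal.tsum_le_tsum fun n => ?_
          gcongr
          · exact hLpow n
          · exact tsum_scaledSum_change_le hW n
      _ = ∑' n : ℕ, 6 * (ENNReal.ofReal ((2 : ℝ) ^ (-T * n)) + 2 * ∑' k,
            ENNReal.ofReal ((2 : ℝ) ^ (-T * n) * min 1 (2 ^ n * weight T (e k)))) := by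
          refine tsum_congr fun n => ?_
          simp_rw [ENNReal.ofReal_mul (Real.rpow_nonneg zero_le_two _), ENNReal.tsum_mul_left]
          ring
      _ = 6 * (∑' n : ℕ, ENNReal.ofReal ((2 : ℝ) ^ (-T * n)) + 2 * ∑' k, ∑' n : ℕ,
            ENNReal.ofReal ((2 : ℝ) ^ (-T * n) * min 1 (2 ^ n * weight T (e k)))) := by
          rw [ENNReal.tsum_mul_left, ENNReal.tsum_add, ENNReal.tsum_mul_left, ENNReal.tsum_comm]
      _ ≤ 6 * (∑' n : ℕ, ENNReal.ofReal ((2 : ℝ) ^ (-T * n)) + 2 * ∑' k,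
            C * (e k).elim 0 fun s => 2⁻¹ ^ s.length) := by
          gcongr with k
          exact hmin k
      _ = 6 * (∑' n : ℕ, ENNReal.ofReal ((2 : ℝ) ^ (-T * n)) + 2 * (C * ∑' k,
            (e k).elim 0 fun s => 2⁻¹ ^ s.length)) := by rw [ENNReal.tsum_mul_left]
    refine ne_top_of_le_ne_top ?_ hle
    exact ENNReal.mul_ne_top (by simp) (ENNReal.add_ne_top.2
      ⟨hgeo, ENNReal.mul_ne_top (by simp) (ENNReal.mul_ne_top hC hfin)⟩)
  obtain ⟨d, hd⟩ := exists_program_of_family hU hq hsum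
  refine ⟨d + 2, fun n _ => ?_⟩
  obtain ⟨k, hk1, hk2, hk3⟩ := exists_scaledSum_near hW ha n
  have hRn : R (k, firstBits a n) = true := by
    rw [hRiff, binVal_firstBits, length_firstBits, hfract]
    exact ⟨hk1, hk2, hk3⟩
  obtain ⟨p, hp, hpl⟩ := hd (k, firstBits a n) (L n) (firstBits a n)
    (by simp [q, hRn, length_firstBits])
  have hle := complexity_le hp
  obtain ⟨p', hp', hpl'⟩ := exists_program_of_complexity_ne_top
    (hle.trans_lt (ENat.natCast_lt_top _)).ne
  rw [coe_complexity_eq hpl', EReal.coe_le_coe_iff]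
  have h2 : p'.length ≤ p.length := by
    rw [hpl'] at hle
    exact_mod_cast hle
  have h3 : (p'.length : ℝ) ≤ L n + d := by exact_mod_cast h2.trans hpl
  push_cast
  linarith [(hLT n).2]

end Compressibility

/-! ### Divergence for `T > 1`. -/

section Divergence

open Filter Topology

/-- All but finitely many of the sets of strings of length `a ^ 2 + 2 a` with value less than
`2 ^ (a ^ 2)` consist of compressible strings. -/
theorem eventually_mem_compressibleStrings {V : List Bool →. List Bool}
    (hV : IsOptimalPrefixFreeMachine V) :
    ∀ᶠ a : ℕ in atTop, ∀ s : List Bool, s.length = a * a + 2 * a → binVal s < 2 ^ (a * a) →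
      s ∈ compressibleStrings V := by
  let R : ℕ × List Bool → Bool := fun y =>
    decide (y.2.length = y.1 * y.1 + 2 * y.1) && decide (binVal y.2 < 2 ^ (y.1 * y.1))
  have ha : Computable fun y : ℕ × List Bool => y.1 := Computable.fst
  have haa : Computable fun y : ℕ × List Bool => y.1 * y.1 := computable_mul ha ha
  have h2 : Computable fun _ : ℕ × List Bool => 2 := Computable.const 2
  have hR : Computable R :=
    computable_and
      (computable_decide_eq (Computable.list_length.comp Computable.snd)
        (computable_add haa (computable_mul h2 ha)))
      (computable_decide_lt (computable_binVal.comp Computable.snd) (computable_pow h2 haa))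
  -- Length `a² + a` leaves measure `2^(-a)` for each `a` after counting the `2^(a²)` strings, which
  -- is summable, and still saves `a` bits on `|s|`, eventually more than the constant `d`.
  let q : ℕ × List Bool → Option (ℕ × List Bool) := fun y =>
    cond (R y) (some (y.1 * y.1 + y.1, y.2)) none
  have hq : Computable q :=
    Computable.cond hR (Computable.option_some.comp
      (Computable.pair (computable_add haa ha) Computable.snd)) (Computable.const none)
  have hRiff : ∀ a s, R (a, s) = true ↔
      s.length = a * a + 2 * a ∧ binVal s < 2 ^ (a * a) := by
    intro a s
    simp [R]
  let G : ℕ × ℕ → ℝ≥0∞ := fun x =>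
    2⁻¹ ^ (x.1 * x.1 + x.1) * if x.2 ∈ Finset.range (2 ^ (x.1 * x.1)) then 1 else 0
  let S := {y : ℕ × List Bool // R y = true}
  have hinj : Function.Injective fun y : S => (y.1.1, binVal y.1.2) := by
    rintro ⟨⟨a, s⟩, hs⟩ ⟨⟨a', s'⟩, hs'⟩ h
    simp only [Prod.mk.injEq] at h
    obtain ⟨rfl, h⟩ := h
    have : s = s' :=
      binVal_injective (((hRiff _ _).1 hs).1.trans ((hRiff _ _).1 hs').1.symm) h
    subst this
    rfl
  have hsum : ∑' y, requestWeight (q y) ≠ ⊤ := by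
    have hsupp : Function.support (fun y => requestWeight (q y)) ⊆
        Set.range (Subtype.val : S → ℕ × List Bool) := by
      intro y hy
      rcases hb : R y with - | -
      · simp [q, hb, requestWeight] at hy
      · exact ⟨⟨y, hb⟩, rfl⟩
    have hqG : ∀ y : S, requestWeight (q y.1) = G (y.1.1, binVal y.1.2) := by
      rintro ⟨⟨a, s⟩, hs⟩
      have h3 := ((hRiff a s).1 hs).2
      simp only [q, hs, G, cond_true, requestWeight, Option.elim_some,
        if_pos (Finset.mem_range.2 h3), mul_one]
    rw [← Subtype.val_injective.tsum_eq hsupp]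
    have hle := calc
      ∑' y : S, requestWeight (q y.1) = ∑' y : S, G (y.1.1, binVal y.1.2) := tsum_congr hqG
      _ ≤ ∑' x, G x := ENNReal.tsum_comp_le_tsum_of_injective hinj G
      _ = ∑' a, ∑' v, G (a, v) := ENNReal.tsum_prod'
      _ = ∑' a : ℕ, (2⁻¹ : ℝ≥0∞) ^ a := by
          refine tsum_congr fun a => ?_
          simp only [G]
          rw [ENNReal.tsum_mul_left,
            tsum_eq_sum (s := Finset.range (2 ^ (a * a))) fun v hv => if_neg hv,
            Finset.sum_ite_mem, Finset.inter_self, Finset.sum_const, Finset.card_range,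
            nsmul_eq_mul, mul_one, pow_add]
          push_cast
          rw [mul_right_comm, ← mul_pow, ENNReal.inv_mul_cancel (by simp) (by simp), one_pow,
            one_mul]
    exact ne_top_of_le_ne_top (tsum_pow_ne_top (by simp)) hle
  obtain ⟨d, hd⟩ := exists_program_of_family hV hq hsum
  filter_upwards [eventually_gt_atTop d] with a had s hs hv
  obtain ⟨p, hp, hpl⟩ := hd (a, s) (a * a + a) s (by simp [q, (hRiff a s).2 ⟨hs, hv⟩])
  refine (complexity_le hp).trans_lt ?_
  have : p.length < s.length := by omega
  exact_mod_cast this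

/-- The compressible blocks contribute `2^(a² - (a² + 2a)/T)`, and for `T > 1` the exponent is at
least `a` as soon as `a (T - 1) ≥ T + 2`. -/
theorem CS_eq_top {V : List Bool →. List Bool} (hV : IsOptimalPrefixFreeMachine V) {T : ℝ}
    (hT : 1 < T) : CS V T = ⊤ := by
  have h0 : 0 < T := by linarith
  have hlow : ∀ᶠ a : ℕ in atTop, ENNReal.ofReal (2 ^ a) ≤ CS V T := by
    have hε : 0 < T - 1 := by linarith
    filter_upwards [eventually_mem_compressibleStrings hV,
      tendsto_natCast_atTop_atTop.eventually_ge_atTop ((T + 2) / (T - 1))] with a ha haT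
    obtain ⟨F, hFc, hF⟩ := exists_finset_binVal_lt (a * a + 2 * a) (2 ^ (a * a))
      (Nat.pow_le_pow_right (by norm_num) (by omega))
    have h1 := card_mul_le_tsum_compressibleStrings (V := V) F
      (fun s => ENNReal.ofReal ((2 : ℝ) ^ (-(s.length : ℝ) / T)))
      (ENNReal.ofReal ((2 : ℝ) ^ (-((a * a + 2 * a : ℕ) : ℝ) / T)))
      fun s hs => ⟨ha s (hF s hs).1 (hF s hs).2, by rw [(hF s hs).1]⟩
    refine le_trans ?_ h1
    rw [hFc, ← ENNReal.ofReal_natCast, ← ENNReal.ofReal_mul (by positivity)]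
    refine ENNReal.ofReal_le_ofReal ?_
    push_cast
    rw [← Real.rpow_natCast, ← Real.rpow_natCast, ← Real.rpow_add (by norm_num)]
    refine Real.rpow_le_rpow_of_exponent_le (by norm_num) ?_
    push_cast
    rw [div_le_iff₀ hε] at haT
    rw [← sub_le_iff_le_add', le_div_iff₀ h0]
    have ha0 : (0 : ℝ) ≤ a := a.cast_nonneg
    nlinarith
  have hlim : Tendsto (fun a : ℕ => ENNReal.ofReal ((2 : ℝ) ^ a)) atTop (𝓝 ⊤) :=
    ENNReal.tendsto_ofReal_atTop.comp (tendsto_pow_atTop_atTop_of_one_lt (by norm_num))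
  exact top_le_iff.1 (le_of_tendsto hlim hlow)

end Divergence

end CompressibleStrings

open CompressibleStrings in
theorem mainTheorem4 (U V : List Bool →. List Bool)
    (hU : IsOptimalPrefixFreeMachine U) (hV : IsOptimalPrefixFreeMachine V)
    (T : ℝ) (hT : 0 < T) :
    (ComputableReal T → T ≤ 1 →
      CS V T ≠ ⊤ ∧ LeftComputable (CS V T).toReal ∧ WeaklyChaitinRandom U T (CS V T).toReal) ∧
    (ComputableReal T → T < 1 →
      CS V T ≠ ⊤ ∧ StrictlyCompressible U T (CS V T).toReal) ∧
    (1 < T → CS V T = ⊤) := by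
  obtain ⟨e, hec, he, hinj⟩ := exists_enumeration hV.1.1
  refine ⟨fun hTc h1 => ?_, fun hTc h1 => ?_, CS_eq_top hV⟩
  · have hfin := CS_ne_top hV.1 hT h1
    have hsum := hasSum_weight hfin he hinj
    exact ⟨hfin, leftComputable_of_hasSum hTc hT hec hsum,
      weaklyChaitinRandom_CS hU.1 hV hTc hT h1 hec he hsum⟩
  · have hfin := CS_ne_top hV.1 hT h1.le
    refine ⟨hfin, strictlyCompressible_of_hasSum hU hTc hT h1 hec (hasSum_weight hfin he hinj)
      (fract_toReal_CS hV.1 hT h1.le) ?_⟩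
    rw [tsum_enumeration he hinj fun s => (2⁻¹ : ℝ≥0∞) ^ s.length]
    exact ((tsum_compressibleStrings_le hV.1).trans_lt (by simp)).ne
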